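/- Let $E/F$ be a finite Galois extension of non-archimedean local fields, and fix a common separable closure $F^{\mathrm{sep}}$ of $F$ and $E$. For $K\in\{F,E\}$ let $W_K$ be the Weil group of $K$, let $W_K^{r}$ be its ramification subgroups in the upper numbering, and let $W_K^{r+}$ be the closure of $\bigcup_{s>r}W_K^{s}$ in $W_K$. Let $\psi=\psi_{E/F}$ be the inverse of the Hasse–Herbrand function $\varphi_{E/F}$. Let $G$ be a connected reductive group over $E$, let $G^\vee$ be its complex Langlands dual group with its action of $W_E$, and let $M^\vee=\mathrm{Ind}_{W_E}^{W_F}G^\vee$ be the induced group; it is the complex dual group of the Weil restriction $M=\mathfrak R_{E/F}G$, with its action of $W_F$. (It consists of the maps $f\colon W_F\to G^\vee$ with $f(wx)={}^{w}f(x)$ for $w\in W_E$, $x\in W_F$ that are constant on the left cosets of some open subgroup of $W_F$, and $({}^{g}f)(x)=f(xg)$.) Both groups carry the discrete topology, and $\mathrm H^1$ denotes the pointed set of classes of continuous $1$-cocycles. The Shapiro map $\mathrm{Sh}\colon \mathrm H^1(W_F,M^\vee)\to \mathrm H^1(W_E,G^\vee)$, $[a]\mapsto[w\mapsto a(w)(1)]$,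 is an isomorphism of pointed sets. For every real number $r\ge 0$ there is a canonical isomorphism of pointed sets $$\mathrm H^1\bigl(W_F/W_F^{r+},(M^\vee)^{W_F^{r+}}\bigr)\;\cong\;\mathrm H^1\bigl(W_E/W_E^{\psi(r)+},(G^\vee)^{W_E^{\psi(r)+}}\bigr).$$ It is the unique map sending the class of each cocycle $a$ to the class of the cocycle induced by $w\mapsto a(wW_F^{r+})(1)$, $w\in W_E$, and it refines $\mathrm{Sh}$: it is compatible with $\mathrm{Sh}$ and the inflation maps to $\mathrm H^1(W_F,M^\vee)$ and $\mathrm H^1(W_E,G^\vee)$. -/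

import Mathlib

open scoped ValuativeRel

noncomputable section

namespace LocalShapiro

/-!
### Rings of integers and ramification groups

Throughout, `R` is the ring of integers of a nonarchimedean local field `F`. For an algebraic
extension `L` of `F`, the ring of integers of `L` (with respect to the unique extension of the
valuation) is the integral closure of `R` in `L`; it is a local ring.
-/

section Ramification

variable (R K L : Type*) [CommRing R] [Field K] [Field L] [Algebra R K] [Algebra R L]
  [Algebra K L] [IsScalarTower R K L]

/-- The ring of integers `𝒪_L`. -/
abbrev ringOfInt : Type _ := integralClosure R L

/-- The maximal ideal of the local ring `𝒪_L`, as its Jacobson radical. -/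
abbrev maxIdeal : Ideal (ringOfInt R L) := Ideal.jacobson ⊥

/-- The action of `Gal(L/K)` on `𝒪_L`. -/
def galInt : Gal(L/K) →* RingAut (ringOfInt R L) where
  toFun σ := ((σ.restrictScalars R).mapIntegralClosure : ringOfInt R L ≃+* ringOfInt R L)
  map_one' := by ext; rfl
  map_mul' _ _ := by ext; rfl

theorem map_maxIdeal (f : RingAut (ringOfInt R L)) :
    (maxIdeal R L).map (f : ringOfInt R L →+* ringOfInt R L) = maxIdeal R L :=
  (Ideal.map_jacobson_of_bijective (f := (f : ringOfInt R L →+* ringOfInt R L))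
    f.bijective).trans (by rw [Ideal.map_bot])

theorem map_maxIdeal_pow (f : RingAut (ringOfInt R L)) (n : ℕ) {x : ringOfInt R L}
    (hx : x ∈ maxIdeal R L ^ n) : f x ∈ maxIdeal R L ^ n := by
  have := Ideal.mem_map_of_mem (f : ringOfInt R L →+* ringOfInt R L) hx
  rwa [Ideal.map_pow, map_maxIdeal] at this

/-- The ramification group `G_u` of `L/K` in the lower numbering, for real `u ≥ -1`: the elements
acting trivially on `𝒪_L / 𝔪_L ^ (⌈u⌉ + 1)`. (It is the whole group for `u ≤ -1`.) -/
def lowerRam (u : ℝ) : Subgroup Gal(L/K) where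
  carrier := {σ | ∀ x : ringOfInt R L,
    galInt R K L σ x - x ∈ maxIdeal R L ^ (⌈u⌉ + 1).toNat}
  one_mem' x := by simp
  mul_mem' {σ τ} hσ hτ x := by
    have := add_mem (map_maxIdeal_pow R L (galInt R K L σ) _ (hτ x)) (hσ x)
    simpa using this
  inv_mem' {σ} hσ x := by
    have := neg_mem (map_maxIdeal_pow R L (galInt R K L σ⁻¹) _ (hσ x))
    rw [map_sub, ← RingAut.mul_apply, ← map_mul] at this
    simpa using this

instance lowerRam_normal (u : ℝ) : (lowerRam R K L u).Normal where
  conj_mem σ hσ τ x := by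
    have := map_maxIdeal_pow R L (galInt R K L τ) _ (hσ (galInt R K L τ⁻¹ x))
    rw [map_sub, ← RingAut.mul_apply, ← RingAut.mul_apply, ← RingAut.mul_apply, ← map_mul,
      ← map_mul, ← map_mul] at this
    simpa using this

/-- The Hasse-Herbrand function `φ_{L/K}(u) = ∫_0^u dt / (G_0 : G_t)` of a finite Galois
extension. With the above convention for `u ≤ -1` it is an increasing bijection of `ℝ`. -/
def herbrandPhi (u : ℝ) : ℝ :=
  ∫ t in (0 : ℝ)..u, (Nat.card (lowerRam R K L t) : ℝ) / Nat.card (lowerRam R K L 0)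

/-- The inverse `ψ_{L/K}` of the Hasse-Herbrand function. -/
def herbrandPsi : ℝ → ℝ := Function.invFun (herbrandPhi R K L)

/-- The ramification group `G^v = G_{ψ(v)}` in the upper numbering. -/
def upperRam (v : ℝ) : Subgroup Gal(L/K) := lowerRam R K L (herbrandPsi R K L v)

instance upperRam_normal (v : ℝ) : (upperRam R K L v).Normal := lowerRam_normal R K L _

/-- The residue field `𝒪_L / 𝔪_L`. -/
def residueRing : Type _ := ringOfInt R L ⧸ maxIdeal R L

instance : CommRing (residueRing R L) := inferInstanceAs (CommRing (ringOfInt R L ⧸ maxIdeal R L))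

instance : Algebra R (residueRing R L) :=
  inferInstanceAs (Algebra R (ringOfInt R L ⧸ maxIdeal R L))

/-- The action of `Gal(L/K)` on the residue field of `L`. -/
def galResidue : Gal(L/K) →* RingAut (residueRing R L) where
  toFun σ := Ideal.quotientEquiv _ _ (galInt R K L σ) (map_maxIdeal R L _).symm
  map_one' := by
    ext x; obtain ⟨x, rfl⟩ := Ideal.Quotient.mk_surjective x
    rfl
  map_mul' σ τ := by
    ext x; obtain ⟨x, rfl⟩ := Ideal.Quotient.mk_surjective x
    rfl

end Ramification

/-! ### Weil groups and their ramification subgroups -/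

section Weil

variable (R K Ω : Type*) [CommRing R] [Field K] [Field Ω] [Algebra R K] [Algebra R Ω]
  [Algebra K Ω] [IsScalarTower R K Ω]

/-- The number `q_K` of elements of the residue field of `K`. -/
def residueCard : ℕ := Nat.card (residueRing R K)

/-- For a separable closure `Ω` of `K`: the elements of `Gal(Ω/K)` which act on the residue field
of `Ω` as an integral power of the Frobenius `x ↦ x ^ q_K` (this describes exactly one
automorphism, so the closure is the infinite cyclic group that it generates). -/
def weilSubgroup : Subgroup Gal(Ω/K) :=
  (Subgroup.closure {φ : RingAut (residueRing R Ω) | ∀ x, φ x = x ^ residueCard R K}).comap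
    (galResidue R K Ω)

/-- The Weil group `W_K`. It is not given the subspace topology of `Gal(Ω/K)`, see below. -/
def WeilGroup : Type _ := weilSubgroup R K Ω

instance : Group (WeilGroup R K Ω) := inferInstanceAs (Group (weilSubgroup R K Ω))

/-- The inclusion of `W_K` in `Gal(Ω/K)`. -/
def WeilGroup.toGal : WeilGroup R K Ω →* Gal(Ω/K) := (weilSubgroup R K Ω).subtype

/-- The action of `W_K` on the residue field of `Ω`; its kernel is the inertia group. -/
def WeilGroup.toResidue : WeilGroup R K Ω →* RingAut (residueRing R Ω) :=
  (galResidue R K Ω).comp (WeilGroup.toGal R K Ω)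

/-- The topology of the Weil group: the coarsest one refining the Krull topology for which the
inertia group is open. -/
instance : TopologicalSpace (WeilGroup R K Ω) :=
  .induced (WeilGroup.toGal R K Ω) inferInstance ⊓
    .induced (WeilGroup.toResidue R K Ω) ⊥

instance : IsTopologicalGroup (WeilGroup R K Ω) :=
  topologicalGroup_inf (topologicalGroup_induced _)
    (by
      let _ : TopologicalSpace (RingAut (residueRing R Ω)) := ⊥
      have : DiscreteTopology (RingAut (residueRing R Ω)) := ⟨rfl⟩
      exact topologicalGroup_induced (WeilGroup.toResidue R K Ω))

/-- The ramification subgroup `W_K^r` (upper numbering): the elements whose restriction to each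
finite Galois extension `L/K` inside `Ω` lies in `Gal(L/K)^r`. -/
def weilRam (r : ℝ) : Subgroup (WeilGroup R K Ω) :=
  ⨅ L : FiniteGaloisIntermediateField K Ω,
    (upperRam R K L r).comap
      ((AlgEquiv.restrictNormalHom L).comp (WeilGroup.toGal R K Ω))

instance weilRam_normal (r : ℝ) : (weilRam R K Ω r).Normal :=
  Subgroup.normal_iInf_normal fun _ => inferInstance

/-- `W_K^{r+}`: the closure in `W_K` of the union of the `W_K^s`, `s > r`. (The `W_K^s` form a
chain, so that the subgroup they generate is their union.) -/
def weilRamPlus (r : ℝ) : Subgroup (WeilGroup R K Ω) :=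
  (⨆ s : Set.Ioi r, weilRam R K Ω s).topologicalClosure

instance weilRamPlus_normal (r : ℝ) : (weilRamPlus R K Ω r).Normal := by
  have : (⨆ s : Set.Ioi r, weilRam R K Ω s).Normal := by
    refine ⟨fun n hn g => ?_⟩
    induction hn using Subgroup.iSup_induction' with
    | hp i x hx => exact Subgroup.mem_iSup_of_mem i ((weilRam_normal R K Ω i).conj_mem x hx g)
    | h1 => simp
    | hmul x y _ _ hx hy => simpa [mul_assoc] using mul_mem hx hy
  exact Subgroup.is_normal_topologicalClosure _

end Weil

/-! ### The inclusion of `W_E` in `W_F` for a finite separable extension `E/F` -/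

section Transfer

variable (F E Ω : Type*) [Field F] [ValuativeRel F] [TopologicalSpace F]
  [IsNonarchimedeanLocalField F] [Field E] [Algebra F E] [Field Ω] [Algebra F Ω] [Algebra E Ω]
  [IsScalarTower F E Ω]

theorem maximalIdeal_le_comap (L : Type*) [Field L] [Algebra F L] :
    𝓂[F] ≤ (maxIdeal 𝒪[F] L).comap (algebraMap 𝒪[F] (ringOfInt 𝒪[F] L)) := by
  intro x hx
  rw [Ideal.mem_comap]
  refine Submodule.mem_sInf.mpr ?_
  rintro J ⟨-, hJ⟩
  have := Ideal.isMaximal_comap_of_isIntegral_of_isMaximal (R := 𝒪[F]) J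
  rw [← IsLocalRing.eq_maximalIdeal this] at hx
  exact hx

def residueMap (L : Type*) [Field L] [Algebra F L] : 𝓀[F] →+* residueRing 𝒪[F] L :=
  Ideal.quotientMap _ _ (maximalIdeal_le_comap F L)

theorem residueCard_eq_pow [FiniteDimensional F E] [Algebra.IsSeparable F E] :
    ∃ f : ℕ, residueCard 𝒪[F] E = Nat.card 𝓀[F] ^ f := by
  have : Module.Finite 𝒪[F] (ringOfInt 𝒪[F] E) :=
    IsIntegralClosure.finite 𝒪[F] F E (ringOfInt 𝒪[F] E)
  have : Module.Finite 𝒪[F] (residueRing 𝒪[F] E) :=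
    Module.Finite.of_surjective
      (Ideal.Quotient.mkₐ 𝒪[F] (maxIdeal 𝒪[F] E)).toLinearMap Ideal.Quotient.mk_surjective
  let _ : Algebra 𝓀[F] (residueRing 𝒪[F] E) :=
    (residueMap F E).toAlgebra
  have : IsScalarTower 𝒪[F] 𝓀[F] (residueRing 𝒪[F] E) := .of_algebraMap_eq fun _ => rfl
  have : Module.Finite 𝓀[F] (residueRing 𝒪[F] E) := .of_restrictScalars_finite 𝒪[F] _ _
  exact ⟨_, Module.natCard_eq_pow_finrank (K := 𝓀[F])⟩

theorem residueCard_self : residueCard 𝒪[F] F = Nat.card 𝓀[F] := by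
  have : Nontrivial (residueRing 𝒪[F] F) := by
    refine Ideal.Quotient.nontrivial_iff.mpr fun h => ?_
    rw [Ideal.jacobson_eq_top_iff] at h
    exact bot_ne_top h
  refine (Nat.card_congr (Equiv.ofBijective (residueMap F F)
    ⟨(residueMap F F).injective, fun y => ?_⟩)).symm
  obtain ⟨⟨y, hy⟩, rfl⟩ := Ideal.Quotient.mk_surjective y
  obtain ⟨x, rfl⟩ := IsIntegrallyClosed.isIntegral_iff.mp hy
  exact ⟨IsLocalRing.residue _ x, rfl⟩

theorem frobeniusSubgroup_le (F E Ω : Type*) [Field F] [ValuativeRel F] [TopologicalSpace F]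
    [IsNonarchimedeanLocalField F] [Field E] [Algebra F E] [Field Ω] [Algebra F Ω]
    [FiniteDimensional F E] [Algebra.IsSeparable F E] :
    Subgroup.closure {φ : RingAut (residueRing 𝒪[F] Ω) | ∀ x, φ x = x ^ residueCard 𝒪[F] E} ≤
      Subgroup.closure {φ : RingAut (residueRing 𝒪[F] Ω) | ∀ x, φ x = x ^ residueCard 𝒪[F] F} := by
  rw [Subgroup.closure_le]
  intro φ hφ
  obtain ⟨f, hf⟩ := residueCard_eq_pow F E
  have := Fintype.ofFinite 𝓀[F]
  simp only [residueCard_self, hf, Set.mem_ofPred_eq, SetLike.mem_coe] at hφ ⊢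
  let _ : Algebra 𝓀[F] (residueRing 𝒪[F] Ω) :=
    (residueMap F Ω).toAlgebra
  let Fr := FiniteField.frobeniusAlgHom 𝓀[F] (residueRing 𝒪[F] Ω)
  have hFr (x) : Fr x = x ^ Nat.card 𝓀[F] := by simp [Fr, Nat.card_eq_fintype_card]
  have hit (n : ℕ) (x) : Fr^[n] x = x ^ (Nat.card 𝓀[F] ^ n) := by
    induction n with
    | zero => simp
    | succ n ih => rw [Function.iterate_succ_apply', ih, hFr, ← pow_mul, pow_succ]
  have hφ' : Fr^[f] = φ := by ext x; rw [hit, hφ]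
  rcases f with _ | f
  · have : φ = 1 := by ext x; simp [hφ]
    rw [this]; exact one_mem _
  have hbij : Function.Bijective Fr := by
    constructor
    · refine Function.Injective.of_comp (f := Fr^[f]) ?_
      rw [← Function.iterate_succ, hφ']; exact φ.injective
    · refine Function.Surjective.of_comp (g := Fr^[f]) ?_
      rw [← Function.iterate_succ', hφ']; exact φ.surjective
  let ψ : RingAut (residueRing 𝒪[F] Ω) := RingEquiv.ofBijective Fr.toRingHom hbij
  have hψ : φ = ψ ^ (f + 1) := by
    ext x
    rw [← hφ']
    generalize f + 1 = n
    induction n generalizing x with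
    | zero => simp
    | succ n ih => rw [Function.iterate_succ_apply, ih, pow_succ]; rfl
  rw [hψ]
  exact pow_mem (Subgroup.subset_closure (show ψ ∈ {φ : RingAut (residueRing 𝒪[F] Ω) |
    ∀ x, φ x = x ^ Nat.card 𝓀[F]} from fun x => hFr x)) _

/-- The inclusion `W_E → W_F` for a finite separable extension `E` of `F` inside `Ω`. -/
def weilIncl [FiniteDimensional F E] [Algebra.IsSeparable F E] :
    WeilGroup 𝒪[F] E Ω →* WeilGroup 𝒪[F] F Ω :=
  ((AlgEquiv.restrictScalarsHom F).comp (weilSubgroup 𝒪[F] E Ω).subtype).codRestrict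
    (weilSubgroup 𝒪[F] F Ω) fun w => frobeniusSubgroup_le F E Ω w.2

theorem continuous_restrictScalarsHom (F E Ω : Type*) [Field F] [Field E] [Algebra F E] [Field Ω]
    [Algebra F Ω] [Algebra E Ω] [IsScalarTower F E Ω] :
    Continuous (AlgEquiv.restrictScalarsHom F : Gal(Ω/E) →* Gal(Ω/F)) := by
  refine continuous_of_continuousAt_one _ fun U hU => ?_
  rw [map_one, krullTopology_mem_nhds_one_iff] at hU
  obtain ⟨L, hL, hLU⟩ := hU
  obtain ⟨s, hs⟩ := Module.Finite.fg_top (R := F) (M := L)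
  let t : Set Ω := Subtype.val '' (s : Set L)
  have ht : t.Finite := s.finite_toSet.image _
  have : Finite t := ht
  have hfin : FiniteDimensional E (IntermediateField.adjoin E t) := by
    refine IntermediateField.finiteDimensional_adjoin fun x hx => ?_
    obtain ⟨y, -, rfl⟩ := hx
    exact ((Algebra.IsIntegral.isIntegral (R := F) y).map L.val).tower_top
  refine Filter.mem_map.mpr <| Filter.mem_of_superset ((krullTopology_mem_nhds_one_iff E Ω
    (IntermediateField.adjoin E t).fixingSubgroup).mpr ⟨IntermediateField.adjoin E t, hfin, subset_rfl⟩) fun σ hσ => hLU ?_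
  intro x
  have key : ∀ y ∈ Submodule.span F (s : Set L), σ (y : Ω) = y := by
    intro y hy
    induction hy using Submodule.span_induction with
    | mem y hy =>
      exact hσ ⟨y, IntermediateField.subset_adjoin E t ⟨y, hy, rfl⟩⟩
    | zero => simp
    | add a b _ _ ha hb => simp [ha, hb]
    | smul c a _ ha =>
      have := map_smul (σ.restrictScalars F) c (a : Ω)
      simp only [AlgEquiv.restrictScalars_apply] at this
      simp [this, ha]
  exact key x (hs ▸ Submodule.mem_top)

theorem continuous_toGal (R K Ω : Type*) [CommRing R] [Field K] [Field Ω] [Algebra R K]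
    [Algebra R Ω] [Algebra K Ω] [IsScalarTower R K Ω] : Continuous (WeilGroup.toGal R K Ω) :=
  continuous_iff_le_induced.mpr inf_le_left

theorem continuous_weilIncl [FiniteDimensional F E] [Algebra.IsSeparable F E] :
    Continuous (weilIncl F E Ω) := by
  refine continuous_inf_rng.mpr ⟨continuous_induced_rng.mpr ?_, continuous_induced_rng.mpr ?_⟩
  · exact (continuous_restrictScalarsHom F E Ω).comp (continuous_toGal 𝒪[F] E Ω)
  · exact continuous_iff_le_induced.mpr inf_le_right

end Transfer

/-! ### Nonabelian continuous cohomology, induced groups and the Shapiro map -/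

section Cohomology

/-- Continuous 1-cocycles of `𝔤` with values in the discrete group `A`. -/
structure Cocycle (𝔤 A : Type*) [Group 𝔤] [TopologicalSpace 𝔤] [Group A]
    [MulDistribMulAction 𝔤 A] where
  toFun : 𝔤 → A
  isLocallyConstant : IsLocallyConstant toFun
  map_mul : ∀ g h, toFun (g * h) = toFun g * g • toFun h

variable (𝔤 A : Type*) [Group 𝔤] [TopologicalSpace 𝔤] [Group A] [MulDistribMulAction 𝔤 A]

instance : CoeFun (Cocycle 𝔤 A) fun _ => 𝔤 → A := ⟨Cocycle.toFun⟩

instance : One (Cocycle 𝔤 A) := ⟨⟨fun _ => 1, .const 1, by simp⟩⟩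

/-- The relation of being cohomologous. -/
instance Cocycle.setoid : Setoid (Cocycle 𝔤 A) where
  r a b := ∃ m : A, ∀ g, b g = m⁻¹ * a g * g • m
  iseqv := by
    refine ⟨fun a => ⟨1, by simp⟩, ?_, ?_⟩
    · rintro a b ⟨m, hm⟩
      exact ⟨m⁻¹, fun g => by simp [hm, mul_assoc]⟩
    · rintro a b c ⟨m, hm⟩ ⟨n, hn⟩
      exact ⟨m * n, fun g => by simp [hm, hn, mul_assoc]⟩

/-- The pointed set `H¹(𝔤, A)`; the base point `1` is the class of the unit cocycle. -/
def H1 : Type _ := Quotient (Cocycle.setoid 𝔤 A)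

variable {𝔤 A}

/-- The class of a cocycle. -/
def Cocycle.cls (a : Cocycle 𝔤 A) : H1 𝔤 A := Quotient.mk _ a

instance : One (H1 𝔤 A) := ⟨(1 : Cocycle 𝔤 A).cls⟩

variable (A) in
/-- The inflation map `H¹(𝔤 / N, A^N) → H¹(𝔤, A)`. -/
def H1.inflation (N : Subgroup 𝔤) [N.Normal] :
    H1 (𝔤 ⧸ N) (FixedPoints.subgroup N A) → H1 𝔤 A :=
  Quotient.map
    (fun a => ⟨fun g => (a (g : 𝔤 ⧸ N) : A),
      (a.isLocallyConstant.comp_continuous QuotientGroup.continuous_mk).comp Subtype.val,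
      fun g h => congrArg Subtype.val (a.map_mul g h)⟩)
    (by
      rintro a b ⟨m, hm⟩
      exact ⟨m, fun g => congrArg Subtype.val (hm g)⟩)

variable {𝔥 : Type*} [Group 𝔥] (ι : 𝔥 →* 𝔤) (B : Type*) [Group B] [MulDistribMulAction 𝔥 B]

/-- The `𝔥`-equivariant maps `𝔤 → B` which are constant on the left cosets of some open subgroup
of `𝔤` (and are therefore continuous for the discrete topology of `B`). -/
def indSubgroup : Subgroup (𝔤 → B) where
  carrier := {f | (∀ x y, f (ι x * y) = x • f y) ∧
    ∃ U : OpenSubgroup 𝔤, ∀ y, ∀ u ∈ U, f (y * u) = f y}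
  one_mem' := ⟨by simp, ⊤, by simp⟩
  mul_mem' := by
    rintro f g ⟨hf, U, hU⟩ ⟨hg, V, hV⟩
    exact ⟨by simp [hf, hg], U ⊓ V, fun y u hu => by simp [hU y u hu.1, hV y u hu.2]⟩
  inv_mem' := by
    rintro f ⟨hf, U, hU⟩
    exact ⟨by simp [hf], U, fun y u hu => by simp [hU y u hu]⟩

/-- The induced group of the `𝔥`-group `B` along the inclusion `ι` of `𝔥` in `𝔤`. -/
def Ind : Type _ := indSubgroup ι B

instance : Group (Ind ι B) := inferInstanceAs (Group (indSubgroup ι B))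

variable {ι B}

instance : CoeFun (Ind ι B) fun _ => 𝔤 → B := ⟨Subtype.val⟩

@[ext] theorem Ind.ext {f g : Ind ι B} (h : ∀ x, f x = g x) : f = g := Subtype.ext (funext h)

/-- `𝔤` acts on the induced group by `(g f)(x) = f (x g)`. -/
instance [IsTopologicalGroup 𝔤] : MulDistribMulAction 𝔤 (Ind ι B) where
  smul g f := ⟨fun x => f (x * g), by
    obtain ⟨f, hf, U, hU⟩ := f
    refine ⟨fun x y => by simp [mul_assoc, hf],
      U.comap (MulAut.conj g⁻¹).toMonoidHom (by
        change Continuous fun x => g⁻¹ * x * g⁻¹⁻¹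
        fun_prop), fun y u hu => ?_⟩
    have := hU (y * g) _ hu
    simpa [mul_assoc] using this⟩
  one_smul f := by ext x; exact congrArg f.1 (mul_one x)
  mul_smul g h f := by ext x; exact congrArg f.1 (mul_assoc x g h).symm
  smul_mul _ _ _ := rfl
  smul_one _ := rfl

theorem Ind.smul_apply [IsTopologicalGroup 𝔤] (g : 𝔤) (f : Ind ι B) (x : 𝔤) :
    (g • f) x = f (x * g) := rfl

variable (ι B) in
/-- The Shapiro map `H¹(𝔤, Ind B) → H¹(𝔥, B)`: restrict a cocycle to `𝔥` and evaluate its values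
at `1`. -/
def shapiro [IsTopologicalGroup 𝔤] [TopologicalSpace 𝔥] (hι : Continuous ι) :
    H1 𝔤 (Ind ι B) → H1 𝔥 B :=
  Quotient.map
    (fun a => ⟨fun x => a (ι x) 1,
      (a.isLocallyConstant.comp_continuous hι).comp fun f : Ind ι B => f 1,
      fun x y => by
        rw [map_mul, a.map_mul]
        change a (ι x) 1 * a (ι y) (1 * ι x) = _
        have := (a (ι y)).2.1 x 1
        rw [one_mul, ← mul_one (ι x), this, mul_one]⟩)
    (by
      rintro a b ⟨m, hm⟩
      refine ⟨m 1, fun x => ?_⟩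
      change b (ι x) 1 = _
      rw [hm]
      change (m 1)⁻¹ * a (ι x) 1 * m (1 * ι x) = _
      have := m.2.1 x 1
      rw [one_mul, ← mul_one (ι x), this, mul_one])

end Cohomology

/-!
### Affine algebraic groups and connected reductive groups

An affine group scheme over a field `k` is given by its coordinate ring, a commutative Hopf algebra
`H` over `k`. For smooth groups the geometric notions are expressed through the group of points in
an algebraically closed extension `C` of `k` and the regular functions on it.
-/

section AlgebraicGroups

open TensorProduct

variable (k H C : Type*) [Field k] [CommRing H] [HopfAlgebra k H] [Field C] [Algebra k C]

/-- The group of `C`-valued points (with the convolution product). -/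
def Points : Type _ := WithConv (H →ₐ[k] C)

namespace Points

instance : Monoid (Points k H C) := inferInstanceAs (Monoid (WithConv (H →ₐ[k] C)))

instance : Group (Points k H C) where
  inv p := WithConv.toConv (p.ofConv.comp (HopfAlgebra.antipodeAlgHom k H))
  inv_mul_cancel p := by
    have h := AlgHom.comp_convMul_distrib p.ofConv
      (WithConv.toConv (HopfAlgebra.antipodeAlgHom k H)) (WithConv.toConv (AlgHom.id k H))
    rw [AlgHom.antipode_id_cancel] at h
    refine WithConv.ext (h.symm.trans ?_)
    ext x
    simp
    rfl

variable {k H C}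

/-- The value of `h : H` at a point. -/
def eval (h : H) (p : Points k H C) : C := p.ofConv h

/-- The action of an automorphism of `C/k` on the points. -/
def galMap (τ : C ≃ₐ[k] C) (p : Points k H C) : Points k H C :=
  WithConv.toConv ((τ : C →ₐ[k] C).comp p.ofConv)

end Points

/-- The regular functions on the base change of the group to `C`. -/
def regularFunctions : Subalgebra C (Points k H C → C) :=
  Algebra.adjoin C (Set.range Points.eval)

variable {k H C}

/-- The subgroup is the zero set of the regular functions vanishing on it. -/
def IsZariskiClosed (S : Subgroup (Points k H C)) : Prop :=
  ∀ p, (∀ f ∈ regularFunctions k H C, (∀ s ∈ S, f s = 0) → f p = 0) → p ∈ S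

/-- Connectedness of a Zariski closed subgroup: no proper closed subgroup has finite index. -/
def IsConnectedSubgroup (S : Subgroup (Points k H C)) : Prop :=
  ∀ S' ≤ S, IsZariskiClosed S' → S'.relIndex S ≠ 0 → S' = S

/-- Unipotent elements: right translation by `p` on the regular functions is locally unipotent. -/
def IsUnipotentElement (p : Points k H C) : Prop :=
  ∀ f ∈ regularFunctions k H C, ∃ n : ℕ,
    ((LinearMap.funLeft C C (· * p) - 1 : Module.End C (Points k H C → C)) ^ n) f = 0

variable (k H C) in
/-- `H` is the coordinate ring of a connected reductive group over `k`: it is of finite type, smooth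
and connected (that is, geometrically integral), and its geometric unipotent radical is trivial.
Here `C` is an algebraic closure of `k`. -/
structure IsConnectedReductive : Prop where
  finiteType : Algebra.FiniteType k H
  isDomain : IsDomain (C ⊗[k] H)
  unipotentRadical_eq_bot : ∀ U : Subgroup (Points k H C), U.Normal → IsZariskiClosed U →
    IsConnectedSubgroup U → (∀ p ∈ U, IsUnipotentElement p) → U = ⊥

/-- The algebraic characters of a closed subgroup `T`, i.e. the elements of `X^*(T)`. -/
def Character (T : Subgroup (Points k H C)) : Type _ :=
  {χ : T →* Cˣ // ∃ f ∈ regularFunctions k H C, ∀ t : T, f t = χ t}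

/-- The algebraic cocharacters of `T`, i.e. the elements of `X_*(T)`: pulling back a regular
function gives a Laurent polynomial. -/
def Cocharacter (T : Subgroup (Points k H C)) : Type _ :=
  {l : Cˣ →* T // ∀ f ∈ regularFunctions k H C, ∃ (q : Polynomial C) (n : ℕ),
    ∀ z : Cˣ, (z : C) ^ n * f (l z) = q.eval (z : C)}

/-- The canonical pairing: `⟨χ, l⟩ = n`. -/
def Pairs {T : Subgroup (Points k H C)} (χ : Character T) (l : Cocharacter T) (n : ℤ) : Prop :=
  ∀ z : Cˣ, χ.1 (l.1 z) = z ^ n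

/-- Tori: closed connected diagonalizable subgroups. -/
structure IsTorus (T : Subgroup (Points k H C)) : Prop where
  closed : IsZariskiClosed T
  connected : IsConnectedSubgroup T
  diagonalizable : ∀ f ∈ regularFunctions k H C,
    (fun t : T => f t) ∈ Submodule.span C (Set.range fun (χ : Character T) (t : T) => (χ.1 t : C))

/-- Maximal tori. -/
def IsMaximalTorus (T : Subgroup (Points k H C)) : Prop := Maximal IsTorus T

/-- Borel subgroups: the maximal closed connected solvable subgroups. -/
def IsBorel (B : Subgroup (Points k H C)) : Prop :=
  Maximal (fun S : Subgroup (Points k H C) =>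
    IsZariskiClosed S ∧ IsConnectedSubgroup S ∧ Group.IsSolvable S) B

/-- `u` is a root homomorphism for `α`: a closed immersion of the additive group with
`t u(a) t⁻¹ = u(α(t) a)`. For a maximal torus `T` of a reductive group, the roots are the nontrivial
characters for which such a `u` exists, and `u` is then unique up to scaling. -/
structure IsRootHom {T : Subgroup (Points k H C)} (α : T →* Cˣ)
    (u : Multiplicative C →* Points k H C) : Prop where
  regular : ∀ f ∈ regularFunctions k H C, ∃ q : Polynomial C,
    ∀ a, f (u (.ofAdd a)) = q.eval a
  closedImmersion : ∃ f ∈ regularFunctions k H C, ∀ a, f (u (.ofAdd a)) = a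
  conj : ∀ (t : T) (a : C),
    (t : Points k H C) * u (.ofAdd a) * (t : Points k H C)⁻¹ = u (.ofAdd (α t * a))

variable {T : Subgroup (Points k H C)}

/-- `α` is a root whose root group lies in the Borel subgroup `B`. -/
def IsPositiveRoot (B : Subgroup (Points k H C)) (α : Character T) : Prop :=
  α.1 ≠ 1 ∧ ∃ u, IsRootHom α.1 u ∧ ∀ a, u a ∈ B

/-- `α` is a positive root which is not the sum of two positive roots. -/
def IsSimpleRoot (B : Subgroup (Points k H C)) (α : Character T) : Prop :=
  IsPositiveRoot B α ∧
    ¬ ∃ β γ : Character T, IsPositiveRoot B β ∧ IsPositiveRoot B γ ∧ α.1 = β.1 * γ.1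

/-- `α` is a root with coroot `l`: there is a homomorphism from `SL₂` carrying the upper and lower
unipotent matrices to the root groups of `α` and of its inverse, and the diagonal ones to `l`. -/
def IsCoroot (α : Character T) (l : Cocharacter T) : Prop :=
  α.1 ≠ 1 ∧ ∃ (φ : Matrix.SpecialLinearGroup (Fin 2) C →* Points k H C)
    (u v : Multiplicative C →* Points k H C), IsRootHom α.1 u ∧ IsRootHom α.1⁻¹ v ∧
    (∀ a : C, φ ⟨!![1, a; 0, 1], by simp⟩ = u (.ofAdd a)) ∧
    (∀ a : C, φ ⟨!![1, 0; a, 1], by simp⟩ = v (.ofAdd a)) ∧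
    ∀ z : Cˣ, φ ⟨!![(z : C), 0; 0, ((z⁻¹ : Cˣ) : C)], by simp⟩ = l.1 z

end AlgebraicGroups

/-! ### The Langlands dual group -/

section LanglandsDual

variable (E Ω H : Type*) [Field E] [Field Ω] [Algebra E Ω] [CommRing H] [HopfAlgebra E H]

/-- A complex Langlands dual group of the connected reductive group over `E` with coordinate ring `H`:
a complex connected reductive group whose based root datum is dual to that of the given group,
with an action of `Gal(Ω/E)` (`Ω` a separable closure of `E`) by algebraic automorphisms which fix a
pinning, induce the given Galois action on the based root datum, and factor through a finite
quotient. -/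
structure LanglandsDual where
  /-- the coordinate ring of the dual group -/
  coordRing : Type*
  [commRing : CommRing coordRing]
  [hopfAlgebra : HopfAlgebra ℂ coordRing]
  isConnectedReductive : IsConnectedReductive ℂ coordRing ℂ
  /-- a Borel pair `(T, B)` of the given group, over an algebraic closure -/
  T : Subgroup (Points E H (AlgebraicClosure Ω))
  B : Subgroup (Points E H (AlgebraicClosure Ω))
  isMaximalTorus_T : IsMaximalTorus T
  isBorel_B : IsBorel B
  T_le_B : T ≤ B
  /-- a Borel pair of the dual group -/
  dualT : Subgroup (Points ℂ coordRing ℂ)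
  dualB : Subgroup (Points ℂ coordRing ℂ)
  isMaximalTorus_dualT : IsMaximalTorus dualT
  isBorel_dualB : IsBorel dualB
  dualT_le_dualB : dualT ≤ dualB
  /-- the identifications `X^*(T) = X_*(dualT)` and `X_*(T) = X^*(dualT)`; being compatible with the
  perfect pairings, they are additive -/
  toCocharacter : Character T ≃ Cocharacter dualT
  toCharacter : Cocharacter T ≃ Character dualT
  pairs_iff : ∀ χ l n, Pairs χ l n ↔ Pairs (toCharacter l) (toCocharacter χ) n
  /-- roots correspond to coroots, and coroots to roots -/
  isCoroot_iff : ∀ α l, IsCoroot α l ↔ IsCoroot (toCharacter l) (toCocharacter α)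
  /-- simple roots correspond to simple coroots -/
  isSimpleRoot_iff : ∀ α l, IsCoroot α l →
    (IsSimpleRoot B α ↔ IsSimpleRoot dualB (toCharacter l))
  /-- the Galois action, by algebraic automorphisms that stabilize the Borel pair -/
  act : Gal(Ω/E) →* MulAut (Points ℂ coordRing ℂ)
  act_algebraic : ∀ σ, ∀ f ∈ regularFunctions ℂ coordRing ℂ,
    f ∘ act σ ∈ regularFunctions ℂ coordRing ℂ
  act_T : ∀ σ, ∀ t ∈ dualT, act σ t ∈ dualT
  act_B : ∀ σ, ∀ b ∈ dualB, act σ b ∈ dualB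
  /-- root homomorphisms for the simple roots (only the values at simple roots matter), permuted
  by the Galois action -/
  pinning : Character dualT → Multiplicative ℂ →* Points ℂ coordRing ℂ
  isRootHom_pinning : ∀ α, IsSimpleRoot dualB α → IsRootHom α.1 (pinning α)
  act_pinning : ∀ σ, ∀ α β : Character dualT, IsSimpleRoot dualB α → IsSimpleRoot dualB β →
    (∀ t : dualT, β.1 ⟨act σ t, act_T σ t t.2⟩ = α.1 t) →
      ∀ a, act σ (pinning α a) = pinning β a
  /-- The action of `σ` on `X_*(dualT) = X^*(T)` is the canonical one: if `τ` extends `σ` and `g` is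
  such that `p ↦ g τ(p) g⁻¹` stabilizes `(T, B)`, then `σ` sends the character `χ` to the character
  `χ'` with `χ'(g τ(t) g⁻¹) = τ(χ(t))`. -/
  act_toCocharacter : ∀ (σ : Gal(Ω/E)) (τ : Gal(AlgebraicClosure Ω/E))
    (g : Points E H (AlgebraicClosure Ω)) (χ χ' : Character T),
    (∀ x : Ω, τ (algebraMap Ω (AlgebraicClosure Ω) x) = algebraMap Ω (AlgebraicClosure Ω) (σ x)) →
    (∀ p, p ∈ T ↔ g * p.galMap τ * g⁻¹ ∈ T) →
    (∀ p, p ∈ B ↔ g * p.galMap τ * g⁻¹ ∈ B) →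
    (∀ t t' : T, (t' : Points E H (AlgebraicClosure Ω)) = g * Points.galMap τ t * g⁻¹ →
      (χ'.1 t' : AlgebraicClosure Ω) = τ (χ.1 t)) →
    ∀ z : ℂˣ, act σ ((toCocharacter χ).1 z) = (toCocharacter χ').1 z
  /-- the action factors through the Galois group of a finite extension -/
  isOpen_ker : IsOpen (act.ker : Set Gal(Ω/E))

namespace LanglandsDual

attribute [instance] commRing hopfAlgebra

variable {E Ω H} (D : LanglandsDual E Ω H)

/-- The complex dual group `G^∨`, as a discrete group. -/
def dualGroup : Type _ := Points ℂ D.coordRing ℂ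

instance : Group D.dualGroup := inferInstanceAs (Group (Points ℂ D.coordRing ℂ))

/-- The Weil group of `E` acts on `G^∨` through `Gal(Ω/E)`. -/
instance (R : Type*) [CommRing R] [Algebra R E] [Algebra R Ω] [IsScalarTower R E Ω] :
    MulDistribMulAction (WeilGroup R E Ω) D.dualGroup :=
  letI : MulDistribMulAction (MulAut (Points ℂ D.coordRing ℂ)) D.dualGroup :=
    inferInstanceAs (MulDistribMulAction (MulAut (Points ℂ D.coordRing ℂ))
      (Points ℂ D.coordRing ℂ))
  MulDistribMulAction.compHom D.dualGroup (D.act.comp (WeilGroup.toGal R E Ω))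

end LanglandsDual

/-- The dual group `M^∨` of the Weil restriction `M` of `G` from `E` to `F`: the induced group
`Ind_{W_E}^{W_F} G^∨`, with its action of `W_F`. -/
abbrev WeilRestrictionDual (F : Type*) {E Ω H : Type*} [Field F] [ValuativeRel F]
    [TopologicalSpace F] [IsNonarchimedeanLocalField F] [Field E] [Algebra F E] [Field Ω]
    [Algebra F Ω] [Algebra E Ω] [IsScalarTower F E Ω] [FiniteDimensional F E]
    [Algebra.IsSeparable F E] [CommRing H] [HopfAlgebra E H] (D : LanglandsDual E Ω H) : Type _ :=
  Ind (weilIncl F E Ω) D.dualGroup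

end LanglandsDual

end LocalShapiro

end

open LocalShapiro

/-!
# Shapiro's isomorphism and the ramification filtrations of Weil groups

There are two independent ingredients, one from group cohomology and one from arithmetic.

*Shapiro's lemma.* Let `ι : 𝔥 → 𝔤` be the inclusion of an open subgroup of finite index. A
`𝔤`-group `A` with a map `ev : A → B` to an `𝔥`-group is coinduced (`IsCoinduced`) if
`a ↦ (x ↦ ev (x • a))` identifies `A` with the smooth equivariant functions `𝔤 → B`; then
`a ↦ ev ∘ a ∘ ι` induces a bijection on `H¹` (`IsCoinduced.h1Map_injective`,
`IsCoinduced.h1Map_surjective`). The inverse is explicit: writing `x = ι (p x) * q x` for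
representatives `q x` of the right cosets, the cocycle `b` comes from the `a` for which `a g` is the
function `x ↦ (b (p x))⁻¹ * b (p (x * g))`. Coinduced groups are stable under passing to
invariants: if `N` is normal in `𝔤`, then `A ^ N` is coinduced from the group of invariants of
`ι⁻¹(N)` in `B` (`IsCoinduced.fixed`). Hence a refined isomorphism exists for each pair `(N, ι⁻¹(N))`;
it is unique because its values are prescribed on the classes of all cocycles, and the compatibility
with inflation holds for the cocycles themselves (`shapiro_refinement`).

*Ramification.* It remains to see that `W_E` is open of finite index in `W_F` and that
`W_E ∩ W_F^{r+} = W_E^{ψ(r)+}` (`comap_weilRamPlus`). As `W_E` is open, forming the intersection with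
it commutes with closures, and the claim reduces to `W_E ∩ W_F^r = W_E^{ψ(r)}`
(`weilIncl_mem_weilRam_iff`). At a finite level, for `L ⊇ M ⊇ K`, this is the compatibility of
the upper numbering with subgroups, which follows from the transitivity `φ_{L/K} = φ_{M/K} ∘ φ_{L/M}`,
since the lower numbering is compatible with subgroups by definition. The passage between different
finite extensions uses Herbrand's theorem, the compatibility of the upper numbering with quotients
(`map_upperRam`).

Both facts on `φ` are combinatorial consequences of the formula
`φ(u) + 1 = (1 / |G_0|) ∑ min (i(s), u + 1)` (`herbrandPhi_add_one`) and of the relation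
`∑ i_L(s) = e * i_M(σ)`, where `s` runs through the elements of `Gal(L/K)` restricting to `σ`
(`IsRamificationTower`). The latter comes from `associated_galInt_sub`, and rests on `𝒪_L` and `𝒪_M`
being generated by one element over `𝒪_F` (`exists_adjoin_ringOfInt_eq_top`).
-/

noncomputable section

namespace LocalShapiro

/-! ### The combinatorics of Herbrand's theorem -/

section Truncation

/-- The real number `min k c`, for an extended natural number `k`. -/
def truncMin (k : ℕ∞) (c : ℝ) : ℝ := k.recTopCoe c fun n => min n c

@[simp] theorem truncMin_top (c : ℝ) : truncMin ⊤ c = c := rfl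

@[simp] theorem truncMin_coe (n : ℕ) (c : ℝ) : truncMin n c = min (n : ℝ) c := rfl

theorem truncMin_monotone (k : ℕ∞) : Monotone (truncMin k) := by
  intro c d h
  induction k with
  | top => simpa
  | coe n => exact min_le_min_left _ h

theorem truncMin_min (k : ℕ∞) (n : ℕ) (c : ℝ) :
    truncMin (min k n) c = truncMin k (truncMin n c) := by
  induction k with
  | top => simp
  | coe k =>
    rw [← (Nat.mono_cast (α := ℕ∞)).map_min]
    simp [min_assoc]

theorem truncMin_natCast_eq (k : ℕ∞) (n : ℕ) : (truncMin k n : ℝ) = ((min k n).toNat : ℝ) := by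
  induction k with
  | top => simp
  | coe k => rw [← (Nat.mono_cast (α := ℕ∞)).map_min]; simp

end Truncation

section Herbrand

open Finset

variable {G Q : Type*} [Group G] [Group Q] {π : G →* Q} {i : G → ℕ∞}

/-- If `s` maximizes `i` on its fibre, the values of `i` on the fibre are the minima
`min (i t) (i s)`, for `t` in the kernel. -/
theorem apply_mul_eq_min (hmul : ∀ s t, min (i s) (i t) ≤ i (s * t)) (hinv : ∀ s, i s⁻¹ = i s)
    {s : G} (hs : ∀ t, π t = 1 → i (s * t) ≤ i s) {t : G} (ht : π t = 1) :
    i (s * t) = min (i t) (i s) := by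
  apply le_antisymm
  · refine le_min ?_ (hs t ht)
    have h1 := hmul s⁻¹ (s * t)
    rw [hinv, inv_mul_cancel_left, min_eq_right (hs t ht)] at h1
    exact h1
  · rw [min_comm]
    exact hmul s t

variable [Fintype G] [DecidableEq Q] (π i) (e : ℕ)

/-- For `c = u + 1 ≥ 1`, this is `φ(u) + 1` for the Hasse-Herbrand function `φ` of the kernel of
`π`, provided that `e` is the order of the inertia group. -/
def kerSum (c : ℝ) : ℝ := (∑ t with π t = 1, truncMin (i t) c) / e

variable {π i e} {j : Q → ℕ∞}

theorem kerSum_strictMono (he : e ≠ 0) (hi1 : i 1 = ⊤) : StrictMono (kerSum π i e) := by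
  intro c d h
  refine div_lt_div_of_pos_right ?_ (by positivity)
  refine sum_lt_sum (fun t _ => truncMin_monotone _ h.le) ⟨1, by simp, by simpa [hi1]⟩

theorem exists_maximizer (hπ : Function.Surjective π) (σ : Q) :
    ∃ s, π s = σ ∧ ∀ t, π t = 1 → i (s * t) ≤ i s := by
  obtain ⟨s₀, hs₀⟩ := hπ σ
  obtain ⟨s, hs, hmax⟩ := exists_max_image ({s | π s = σ} : Finset G) i ⟨s₀, by simpa⟩
  refine ⟨s, by simpa using hs, fun t ht => hmax _ ?_⟩
  simpa [ht] using hs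

theorem sum_fiber_eq {M : Type*} [AddCommMonoid M] (f : G → M) (s : G) :
    ∑ s' with π s' = π s, f s' = ∑ t with π t = 1, f (s * t) := by
  refine sum_bij' (fun s' _ => s⁻¹ * s') (fun t _ => s * t) ?_ ?_ ?_ ?_ ?_ <;> simp +contextual

/-- The values of `j` are those of the Hasse-Herbrand function at the maxima over the fibres. -/
theorem eq_kerSum (hmul : ∀ s t, min (i s) (i t) ≤ i (s * t)) (hinv : ∀ s, i s⁻¹ = i s)
    (he : e ≠ 0) (hsum : ∀ σ, e * j σ = ∑ s with π s = σ, i s) {s : G}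
    (hs : ∀ t, π t = 1 → i (s * t) ≤ i s) {m k : ℕ} (hm : i s = m) (hk : j (π s) = k) :
    (k : ℝ) = kerSum π i e m := by
  have h := hsum (π s)
  rw [sum_fiber_eq, sum_congr rfl (g := fun t => ((min (i t) m).toNat : ℕ∞)), ← Nat.cast_sum, hk,
    ← Nat.cast_mul, Nat.cast_inj] at h
  · rw [kerSum, eq_div_iff (by positivity)]
    simp_rw [truncMin_natCast_eq]
    rw [mul_comm]
    exact_mod_cast h
  · intro t ht
    rw [apply_mul_eq_min hmul hinv hs (by simpa using ht), hm, ENat.natCast_toNat]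
    exact ne_top_of_le_ne_top (ENat.natCast_ne_top m) (min_le_right _ _)

variable (π i e j) in
/-- The axioms satisfied by the functions `i` and `j` which define the ramification filtrations of
the Galois groups `G` and `Q` of a Galois extension and of a Galois subextension, where `π` is the
restriction map and `e` is the ramification index of the top layer. -/
structure IsRamificationTower : Prop where
  surjective : Function.Surjective π
  le_mul : ∀ s t, min (i s) (i t) ≤ i (s * t)
  inv : ∀ s, i s⁻¹ = i s
  eq_top_iff : ∀ s, i s = ⊤ ↔ s = 1
  eq_top_iff' : ∀ σ, j σ = ⊤ ↔ σ = 1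
  ne_zero : e ≠ 0
  sum_fiber : ∀ σ, e * j σ = ∑ s with π s = σ, i s

namespace IsRamificationTower

/-- Transitivity of the Hasse-Herbrand function, fibre by fibre. -/
theorem sum_fiber_truncMin (h : IsRamificationTower π i e j) (σ : Q) (c : ℝ) :
    ∑ s with π s = σ, truncMin (i s) c = e * truncMin (j σ) (kerSum π i e c) := by
  have he' : (e : ℝ) ≠ 0 := Nat.cast_ne_zero.mpr h.ne_zero
  by_cases hσ : σ = 1
  · rw [(h.eq_top_iff' σ).mpr hσ, truncMin_top, kerSum, mul_div_cancel₀ _ he', hσ]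
  obtain ⟨s, rfl, hs⟩ := exists_maximizer (i := i) h.surjective σ
  obtain ⟨m, hm⟩ := ENat.ne_top_iff_exists.mp fun h' => hσ (by rw [(h.eq_top_iff s).mp h', map_one])
  obtain ⟨k, hk⟩ := ENat.ne_top_iff_exists.mp fun h' => hσ ((h.eq_top_iff' _).mp h')
  rw [← hk, truncMin_coe, eq_kerSum h.le_mul h.inv h.ne_zero h.sum_fiber hs hm.symm hk.symm,
    ← (kerSum_strictMono h.ne_zero ((h.eq_top_iff 1).mpr rfl)).monotone.map_min, kerSum,
    mul_div_cancel₀ _ he', sum_fiber_eq]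
  refine sum_congr rfl fun t ht => ?_
  rw [apply_mul_eq_min h.le_mul h.inv hs (by simpa using ht), ← hm, truncMin_min, truncMin_coe]

/-- Herbrand's theorem: the image of a ramification group in the lower numbering. -/
theorem exists_fiber_truncMin_eq_iff (h : IsRamificationTower π i e j) (σ : Q) (c : ℝ) :
    (∃ s, π s = σ ∧ truncMin (i s) c = c) ↔
      truncMin (j σ) (kerSum π i e c) = kerSum π i e c := by
  by_cases hσ : σ = 1
  · rw [(h.eq_top_iff' σ).mpr hσ, truncMin_top]
    refine iff_of_true ⟨1, by rw [map_one, hσ], by rw [(h.eq_top_iff 1).mpr rfl, truncMin_top]⟩ rfl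
  obtain ⟨s, rfl, hs⟩ := exists_maximizer (i := i) h.surjective σ
  obtain ⟨m, hm⟩ := ENat.ne_top_iff_exists.mp fun h' => hσ (by rw [(h.eq_top_iff s).mp h', map_one])
  obtain ⟨k, hk⟩ := ENat.ne_top_iff_exists.mp fun h' => hσ ((h.eq_top_iff' _).mp h')
  rw [← hk, truncMin_coe, min_eq_right_iff,
    eq_kerSum h.le_mul h.inv h.ne_zero h.sum_fiber hs hm.symm hk.symm,
    (kerSum_strictMono h.ne_zero ((h.eq_top_iff 1).mpr rfl)).le_iff_le]
  constructor
  · rintro ⟨s', hs', h'⟩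
    have hle : i s' ≤ m := by
      have := hs (s⁻¹ * s') (by rw [map_mul, map_inv, hs', inv_mul_cancel])
      rwa [mul_inv_cancel_left, ← hm] at this
    obtain ⟨n, hn⟩ := ENat.ne_top_iff_exists.mp (ne_top_of_le_ne_top (ENat.natCast_ne_top m) hle)
    rw [← hn, truncMin_coe, min_eq_right_iff] at h'
    rw [← hn, Nat.cast_le] at hle
    exact h'.trans (by exact_mod_cast hle)
  · exact fun h' => ⟨s, rfl, by rw [← hm, truncMin_coe, min_eq_right h']⟩

end IsRamificationTower

end Herbrand

/-! ### The Hasse-Herbrand function -/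

section Depth

variable (R K : Type*) {L : Type*} [CommRing R] [Field K] [Field L] [Algebra R K] [Algebra R L]
  [Algebra K L] [IsScalarTower R K L]

/-- The function `i_{L/K}` on `Gal(L/K)`: the supremum of those `n` for which `σ` acts trivially on
`𝒪_L / 𝔪_L ^ n`. The ramification group `G_u` is given by the condition `i_{L/K}(σ) ≥ u + 1`. -/
def depth (σ : Gal(L/K)) : ℕ∞ :=
  ⨆ (n : ℕ) (_ : ∀ x : ringOfInt R L, galInt R K L σ x - x ∈ maxIdeal R L ^ n), (n : ℕ∞)

variable {R K}

theorem natCast_le_depth_iff {σ : Gal(L/K)} {n : ℕ} :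
    (n : ℕ∞) ≤ depth R K σ ↔
      ∀ x : ringOfInt R L, galInt R K L σ x - x ∈ maxIdeal R L ^ n := by
  refine ⟨fun h => ?_, fun h => le_iSup₂_of_le n h le_rfl⟩
  by_contra hn
  obtain _ | n := n
  · exact hn fun x => by simp
  have : depth R K σ ≤ n := iSup₂_le fun k hk => by
    by_contra! hlt
    exact hn fun x => Ideal.pow_le_pow_right (by exact_mod_cast hlt) (hk x)
  have := h.trans this
  norm_cast at this
  omega

theorem natCast_le_depth_iff_mem {σ : Gal(L/K)} {n : ℕ} :
    (n : ℕ∞) ≤ depth R K σ ↔ σ ∈ lowerRam R K L (n - 1) := by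
  rw [natCast_le_depth_iff]
  change _ ↔ ∀ x : ringOfInt R L, _ ∈ maxIdeal R L ^ (⌈(n : ℝ) - 1⌉ + 1).toNat
  simp

theorem min_depth_le (σ τ : Gal(L/K)) :
    min (depth R K σ) (depth R K τ) ≤ depth R K (σ * τ) := by
  refine ENat.forall_natCast_le_iff_le.mp fun n hn => ?_
  rw [le_min_iff, natCast_le_depth_iff_mem, natCast_le_depth_iff_mem] at hn
  exact natCast_le_depth_iff_mem.mpr (mul_mem hn.1 hn.2)

theorem depth_inv (σ : Gal(L/K)) : depth R K σ⁻¹ = depth R K σ :=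
  ENat.eq_of_forall_natCast_le_iff fun n => by
    rw [natCast_le_depth_iff_mem, natCast_le_depth_iff_mem, inv_mem_iff]

theorem depth_one : depth R K (1 : Gal(L/K)) = ⊤ :=
  ENat.eq_top_iff_forall_ge.mpr fun _ => natCast_le_depth_iff_mem.mpr (one_mem _)

theorem mem_lowerRam_iff {σ : Gal(L/K)} {u : ℝ} :
    σ ∈ lowerRam R K L u ↔ truncMin (depth R K σ) (u + 1) = u + 1 := by
  change (∀ x : ringOfInt R L, _ ∈ maxIdeal R L ^ (⌈u⌉ + 1).toNat) ↔ _
  rw [← natCast_le_depth_iff]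
  induction depth R K σ with
  | top => simp
  | coe n =>
    rw [Nat.cast_le, Int.toNat_le, truncMin_coe, min_eq_right_iff, ← le_sub_iff_add_le,
      ← le_sub_iff_add_le, Int.ceil_le]
    simp

end Depth

section Phi

open MeasureTheory

theorem antitone_truncMin_indicator (k : ℕ∞) :
    Antitone fun t : ℝ => if truncMin k (t + 1) = t + 1 then (1 : ℝ) else 0 := by
  intro s t hst
  dsimp only
  split_ifs with h1 h2
  · exact le_rfl
  · refine absurd ?_ h2
    induction k with
    | top => rfl
    | coe n =>
      rw [truncMin_coe, min_eq_right_iff] at *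
      linarith
  · exact zero_le_one
  · exact le_rfl

theorem integral_truncMin_indicator (k : ℕ∞) {u : ℝ} (hu : 0 ≤ u) :
    ∫ t in (0 : ℝ)..u, (if truncMin k (t + 1) = t + 1 then (1 : ℝ) else 0) =
      truncMin k (u + 1) - truncMin k 1 := by
  induction k with
  | top => simp
  | coe n =>
    simp only [truncMin_coe, min_eq_right_iff]
    obtain _ | n := n
    · rw [Nat.cast_zero, min_eq_left (by linarith), min_eq_left zero_le_one, sub_zero]
      refine intervalIntegral.integral_zero_ae (.of_forall fun t ht => ?_)
      rw [Set.uIoc_of_le hu] at ht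
      exact if_neg (by linarith [ht.1])
    · rw [min_eq_right (b := (1 : ℝ)) (by simp)]
      have (t : ℝ) : (if t + 1 ≤ ((n + 1 : ℕ) : ℝ) then (1 : ℝ) else 0) =
          Set.indicator {t | t ≤ (n : ℝ)} (fun _ => (1 : ℝ)) t := by
        simp [Set.indicator_apply]
      simp_rw [this]
      rcases le_total (n : ℝ) u with h | h
      · rw [intervalIntegral.integral_indicator ⟨by positivity, h⟩,
          min_eq_left (by push_cast; linarith)]
        simp
      · rw [min_eq_right (by push_cast; linarith), intervalIntegral.integral_congr
          (g := fun _ => (1 : ℝ)) fun t ht => Set.indicator_of_mem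
            (show t ∈ {t : ℝ | t ≤ (n : ℝ)} by rw [Set.uIcc_of_le hu] at ht; exact ht.2.trans h) _]
        simp

variable {R K L : Type*} [CommRing R] [Field K] [Field L] [Algebra R K] [Algebra R L]
  [Algebra K L] [IsScalarTower R K L]

variable (R K L) in
@[simp] theorem herbrandPhi_zero : herbrandPhi R K L 0 = 0 := by simp [herbrandPhi]

theorem lowerRam_antitone : Antitone (lowerRam R K L) := fun u v h σ hσ x =>
  Ideal.pow_le_pow_right (Int.toNat_le_toNat (by gcongr)) (hσ x)

variable [FiniteDimensional K L]

theorem card_lowerRam (u : ℝ) : (Nat.card (lowerRam R K L u) : ℝ) =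
    ∑ σ : Gal(L/K), if truncMin (depth R K σ) (u + 1) = u + 1 then (1 : ℝ) else 0 := by
  classical
  rw [← Finset.sum_filter, Finset.sum_const, nsmul_one, Nat.cast_inj]
  change Nat.card {σ // σ ∈ lowerRam R K L u} = _
  simp_rw [mem_lowerRam_iff]
  rw [Nat.card_eq_fintype_card, Fintype.card_subtype]

theorem card_lowerRam_pos (u : ℝ) : (0 : ℝ) < Nat.card (lowerRam R K L u) := by
  exact_mod_cast Nat.card_pos

theorem sum_truncMin_depth_one :
    ∑ σ : Gal(L/K), truncMin (depth R K σ) 1 = Nat.card (lowerRam R K L 0) := by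
  rw [card_lowerRam, zero_add]
  refine Finset.sum_congr rfl fun σ _ => ?_
  induction depth R K σ with
  | top => simp
  | coe n =>
    obtain _ | n := n
    · rw [truncMin_coe]; simp
    · rw [truncMin_coe]; simp

theorem intervalIntegrable_card_lowerRam (a b : ℝ) :
    IntervalIntegrable (fun t => (Nat.card (lowerRam R K L t) : ℝ) / Nat.card (lowerRam R K L 0))
      volume a b := by
  refine IntervalIntegrable.div_const (Antitone.intervalIntegrable fun s t h => ?_) _
  exact_mod_cast Subgroup.card_le_of_le (lowerRam_antitone h)

/-- The formula `φ(u) + 1 = (1 / |G_0|) ∑ min (i(σ), u + 1)`. -/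
theorem herbrandPhi_add_one {u : ℝ} (hu : 0 ≤ u) : herbrandPhi R K L u + 1 =
    (∑ σ : Gal(L/K), truncMin (depth R K σ) (u + 1)) / Nat.card (lowerRam R K L 0) := by
  have h0 := (card_lowerRam_pos (R := R) (K := K) (L := L) 0).ne'
  rw [herbrandPhi, intervalIntegral.integral_div, eq_div_iff h0, add_mul, div_mul_cancel₀ _ h0,
    one_mul, ← sum_truncMin_depth_one]
  simp_rw [card_lowerRam]
  rw [intervalIntegral.integral_finsetSum fun σ _ =>
    (antitone_truncMin_indicator _).intervalIntegrable, ← Finset.sum_add_distrib]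
  refine Finset.sum_congr rfl fun σ _ => ?_
  rw [integral_truncMin_indicator _ hu, sub_add_cancel]

theorem le_herbrandPhi_sub {a b : ℝ} (h : a ≤ b) :
    (b - a) / Nat.card (lowerRam R K L 0) ≤ herbrandPhi R K L b - herbrandPhi R K L a := by
  rw [herbrandPhi, herbrandPhi, intervalIntegral.integral_interval_sub_left
    (intervalIntegrable_card_lowerRam _ _) (intervalIntegrable_card_lowerRam _ _)]
  have h1 : ∫ _ in a..b, (1 : ℝ) / Nat.card (lowerRam R K L 0) =
      (b - a) / Nat.card (lowerRam R K L 0) := by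
    rw [intervalIntegral.integral_const, smul_eq_mul, mul_one_div]
  rw [← h1]
  refine intervalIntegral.integral_mono_on h (by simp) (intervalIntegrable_card_lowerRam _ _)
    fun t _ => ?_
  gcongr
  exact_mod_cast Nat.card_pos

theorem herbrandPhi_strictMono : StrictMono (herbrandPhi R K L) := fun a b h => by
  have h1 := le_herbrandPhi_sub (R := R) (K := K) (L := L) h.le
  have h2 : 0 < (b - a) / Nat.card (lowerRam R K L 0) :=
    div_pos (sub_pos.mpr h) (card_lowerRam_pos 0)
  linarith

theorem exists_herbrandPhi_eq {v : ℝ} (hv : 0 ≤ v) : ∃ u, 0 ≤ u ∧ herbrandPhi R K L u = v := by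
  have hc := card_lowerRam_pos (R := R) (K := K) (L := L) 0
  have hu : 0 ≤ v * Nat.card (lowerRam R K L 0) := by positivity
  have hcont : Continuous (herbrandPhi R K L) :=
    intervalIntegral.continuous_primitive intervalIntegrable_card_lowerRam 0
  have h1 := le_herbrandPhi_sub (R := R) (K := K) (L := L) hu
  rw [sub_zero, mul_div_cancel_right₀ _ hc.ne', herbrandPhi_zero, sub_zero] at h1
  obtain ⟨u, hu, h⟩ := intermediate_value_Icc hu hcont.continuousOn
    ⟨(herbrandPhi_zero R K L).trans_le hv, h1⟩
  exact ⟨u, hu.1, h⟩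

theorem herbrandPsi_herbrandPhi (u : ℝ) : herbrandPsi R K L (herbrandPhi R K L u) = u :=
  Function.leftInverse_invFun herbrandPhi_strictMono.injective u

theorem herbrandPhi_herbrandPsi {v : ℝ} (hv : 0 ≤ v) :
    herbrandPhi R K L (herbrandPsi R K L v) = v :=
  Function.invFun_eq ((exists_herbrandPhi_eq hv).imp fun _ h => h.2)

theorem herbrandPsi_nonneg {v : ℝ} (hv : 0 ≤ v) : 0 ≤ herbrandPsi R K L v := by
  rw [← herbrandPhi_strictMono (R := R) (K := K) (L := L).le_iff_le, herbrandPhi_zero,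
    herbrandPhi_herbrandPsi hv]
  exact hv

theorem herbrandPhi_nonneg {u : ℝ} (hu : 0 ≤ u) : 0 ≤ herbrandPhi R K L u := by
  rw [← herbrandPhi_zero R K L]
  exact herbrandPhi_strictMono.monotone hu

theorem herbrandPsi_lt_iff {v w : ℝ} (hv : 0 ≤ v) (hw : 0 ≤ w) :
    herbrandPsi R K L v < herbrandPsi R K L w ↔ v < w := by
  rw [← herbrandPhi_strictMono (R := R) (K := K) (L := L).lt_iff_lt, herbrandPhi_herbrandPsi hv,
    herbrandPhi_herbrandPsi hw]

theorem upperRam_antitone {v w : ℝ} (hv : 0 ≤ v) (h : v ≤ w) :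
    upperRam R K L w ≤ upperRam R K L v :=
  lowerRam_antitone (not_lt.mp fun h' => h.not_gt
    ((herbrandPsi_lt_iff (hv.trans h) hv).mp h'))

end Phi

/-! ### Rings of integers of finite extensions of a local field -/

section Spectral

open Polynomial

variable {A K L : Type*} [CommRing A] [IsDomain A] [IsIntegrallyClosed A]
  [NontriviallyNormedField K] [Algebra A K]
  [IsFractionRing A K] [Field L] [Algebra K L] [Algebra A L] [IsScalarTower A K L]
  [Algebra.IsAlgebraic K L]

theorem isIntegral_iff_spectralNorm_le_one
    (hA : ∀ x : K, ‖x‖ ≤ 1 ↔ x ∈ (algebraMap A K).range) (y : L) :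
    IsIntegral A y ↔ spectralNorm K L y ≤ 1 := by
  have hint : IsIntegral K y := Algebra.IsIntegral.isIntegral y
  rw [spectralNorm, spectralValue_le_one_iff (minpoly.monic hint)]
  constructor
  · intro hy n
    rw [minpoly.isIntegrallyClosed_eq_field_fractions' K hy, coeff_map, hA]
    exact ⟨_, rfl⟩
  · intro h
    have hl : minpoly K y ∈ lifts (algebraMap A K) :=
      (lifts_iff_coeff_lifts _).mpr fun n => (hA _).mp (h n)
    obtain ⟨p, hp, -, hmonic⟩ := lifts_and_natDegree_eq_and_monic hl (minpoly.monic hint)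
    refine ⟨p, hmonic, ?_⟩
    rw [IsScalarTower.algebraMap_eq A K L, ← eval₂_map, hp]
    exact minpoly.aeval K y

variable [CompleteSpace K] [IsUltrametricDist K]

/-- Over a complete field, the integral closure of the ring of integers in an algebraic extension
is the unit ball of a multiplicative nonarchimedean norm. -/
theorem isLocalRing_integralClosure
    (hA : ∀ x : K, ‖x‖ ≤ 1 ↔ x ∈ (algebraMap A K).range) : IsLocalRing (integralClosure A L) := by
  have hmem (y : L) : y ∈ integralClosure A L ↔ spectralNorm K L y ≤ 1 :=
    isIntegral_iff_spectralNorm_le_one hA y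
  have hunit (y : integralClosure A L) : IsUnit y ↔ spectralNorm K L y = 1 := by
    constructor
    · rintro ⟨u, rfl⟩
      refine le_antisymm ((hmem _).mp u.1.2) ?_
      have h1 := (hmem _).mp (u⁻¹).1.2
      have h2 : spectralMulAlgNorm K L (u.1 : L) * spectralMulAlgNorm K L ((u⁻¹).1 : L) = 1 := by
        rw [← map_mul, ← Subalgebra.coe_mul, Units.mul_inv, Subalgebra.coe_one, map_one]
      rw [spectralMulAlgNorm_def, spectralMulAlgNorm_def] at h2
      rw [← h2]
      exact mul_le_of_le_one_right (spectralNorm_nonneg _) h1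
    · intro h
      have h0 : (y : L) ≠ 0 := fun h0 => by
        rw [h0, spectralNorm_zero] at h
        exact zero_ne_one h
      have h2 : spectralMulAlgNorm K L (y : L) * spectralMulAlgNorm K L (y : L)⁻¹ = 1 := by
        rw [← map_mul, mul_inv_cancel₀ h0, map_one]
      rw [spectralMulAlgNorm_def, spectralMulAlgNorm_def, h, one_mul] at h2
      exact IsUnit.of_mul_eq_one ⟨(y : L)⁻¹, (hmem _).mpr h2.le⟩ (Subtype.ext (mul_inv_cancel₀ h0))
  refine IsLocalRing.of_nonunits_add fun a b ha hb => ?_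
  rw [mem_nonunits_iff, hunit] at *
  replace ha := lt_of_le_of_ne ((hmem _).mp a.2) ha
  replace hb := lt_of_le_of_ne ((hmem _).mp b.2) hb
  exact ((isNonarchimedean_spectralNorm (a : L) (b : L)).trans_lt (max_lt ha hb)).ne

end Spectral

section Monogenic

open IsLocalRing Polynomial

variable {S : Type*} [CommRing S] [IsDomain S] [IsDiscreteValuationRing S]

/-- There is an `x` generating the units of the residue field with `x ^ q - x` a uniformizer. Indeed,
replacing `x` by `x + ϖ`, for a uniformizer `ϖ`, changes `x ^ q - x` by `-ϖ` modulo `ϖ ^ 2`. -/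
theorem exists_generator_residueField [Finite (ResidueField S)] :
    ∃ x : S, (∀ y : ResidueField S, y ≠ 0 → ∃ n : ℕ, residue S x ^ n = y) ∧
      Irreducible (x ^ Nat.card (ResidueField S) - x) := by
  have := Fintype.ofFinite (ResidueField S)
  set q := Nat.card (ResidueField S) with hq
  obtain ⟨ζ, hζ⟩ := IsCyclic.exists_generator (α := (ResidueField S)ˣ)
  obtain ⟨x₀, hx₀⟩ := residue_surjective (ζ : ResidueField S)
  have hgen (x : S) (hx : residue S x = ζ) (y : ResidueField S) (hy : y ≠ 0) :
      ∃ n : ℕ, residue S x ^ n = y := by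
    obtain ⟨n, hn⟩ := (mem_powers_iff_mem_zpowers).mpr (hζ (Units.mk0 y hy))
    exact ⟨n, by rw [hx, ← Units.val_pow_eq_pow_val]; exact congrArg Units.val hn⟩
  have hmem (x : S) : x ^ q - x ∈ maximalIdeal S := by
    rw [← residue_eq_zero_iff, map_sub, map_pow, hq, Nat.card_eq_fintype_card,
      FiniteField.pow_card, sub_self]
  obtain ⟨ϖ, hϖ⟩ := IsDiscreteValuationRing.exists_irreducible S
  have hirr (z : S) (hz : z ∈ maximalIdeal S) (hz' : ¬ ϖ ^ 2 ∣ z) : Irreducible z := by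
    rw [hϖ.maximalIdeal_eq, Ideal.mem_span_singleton] at hz
    obtain ⟨w, rfl⟩ := hz
    refine (irreducible_mul_isUnit (x := w) ?_).mpr hϖ
    by_contra hw
    rw [← mem_nonunits_iff, ← mem_maximalIdeal, hϖ.maximalIdeal_eq,
      Ideal.mem_span_singleton] at hw
    exact hz' (by rw [sq]; exact mul_dvd_mul_left _ hw)
  by_cases h : ϖ ^ 2 ∣ x₀ ^ q - x₀
  · have hϖ0 : residue S ϖ = 0 := by
      rw [residue_eq_zero_iff, hϖ.maximalIdeal_eq]
      exact Ideal.mem_span_singleton_self ϖ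
    refine ⟨x₀ + ϖ, hgen _ (by rw [map_add, hϖ0, add_zero, hx₀]), hirr _ (hmem _) fun h' => ?_⟩
    obtain ⟨k, hk⟩ := (X ^ q - X : S[X]).binomExpansion x₀ ϖ
    simp only [eval_sub, eval_pow, eval_X, derivative_sub, derivative_X_pow, derivative_X,
      eval_mul, eval_one, map_natCast, eval_natCast] at hk
    rw [hk] at h'
    have h2 : ϖ * ϖ ∣ ϖ * (q * x₀ ^ (q - 1) - 1) := by
      have := dvd_sub (dvd_sub h' h) (Dvd.intro_left k rfl : ϖ ^ 2 ∣ k * ϖ ^ 2)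
      rw [← sq]
      convert this using 1
      ring
    have h3 := (mul_dvd_mul_iff_left hϖ.ne_zero).mp h2
    rw [← Ideal.mem_span_singleton, ← hϖ.maximalIdeal_eq, ← residue_eq_zero_iff, map_sub, map_mul,
      map_natCast, hq, Nat.card_eq_fintype_card, FiniteField.cast_card_eq_zero, zero_mul, map_one,
      zero_sub, neg_eq_zero] at h3
    exact one_ne_zero h3
  · exact ⟨x₀, hgen _ hx₀, hirr _ (hmem _) h⟩

/-- A finite extension of discrete valuation rings with finite residue fields is monogenic. -/
theorem exists_adjoin_eq_top [Finite (ResidueField S)] (R : Type*) [CommRing R] [IsLocalRing R]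
    [Algebra R S] [Module.Finite R S] [FaithfulSMul R S] (hR : ¬ IsField R) :
    ∃ x : S, Algebra.adjoin R {x} = ⊤ := by
  obtain ⟨x, hx, hϖ⟩ := exists_generator_residueField (S := S)
  set ϖ := x ^ Nat.card (ResidueField S) - x
  refine ⟨x, ?_⟩
  have hxA : x ∈ Algebra.adjoin R {x} := Algebra.self_mem_adjoin_singleton R x
  have hϖA : ϖ ∈ Algebra.adjoin R {x} := sub_mem (pow_mem hxA _) hxA
  have happrox (n : ℕ) (z : S) : ∃ a ∈ Algebra.adjoin R {x}, z - a ∈ maximalIdeal S ^ n := by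
    induction n with
    | zero => exact ⟨0, zero_mem _, by simp⟩
    | succ n ih =>
      obtain ⟨a, ha, hza⟩ := ih
      rw [hϖ.maximalIdeal_eq, Ideal.span_singleton_pow, Ideal.mem_span_singleton] at hza
      obtain ⟨w, hw⟩ := hza
      have : ∃ c ∈ Algebra.adjoin R {x}, residue S c = residue S w := by
        by_cases h0 : residue S w = 0
        · exact ⟨0, zero_mem _, by rw [h0, map_zero]⟩
        · obtain ⟨k, hk⟩ := hx _ h0
          exact ⟨x ^ k, pow_mem hxA k, by rw [map_pow, hk]⟩
      obtain ⟨c, hc, hcw⟩ := this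
      refine ⟨a + ϖ ^ n * c, add_mem ha (mul_mem (pow_mem hϖA n) hc), ?_⟩
      rw [show z - (a + ϖ ^ n * c) = ϖ ^ n * (w - c) by rw [← sub_sub, hw]; ring, pow_succ]
      refine Ideal.mul_mem_mul (Ideal.pow_mem_pow ?_ n) ?_
      · rw [hϖ.maximalIdeal_eq]; exact Ideal.mem_span_singleton_self ϖ
      · rw [← residue_eq_zero_iff, map_sub, hcw, sub_self]
  have hmap : (maximalIdeal R).map (algebraMap R S) ≠ ⊥ := by
    rw [Ne, Ideal.map_eq_bot_iff_of_injective (FaithfulSMul.algebraMap_injective R S)]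
    exact fun h => hR (isField_iff_maximalIdeal_eq.mpr h)
  obtain ⟨n, hn⟩ := IsDiscreteValuationRing.ideal_eq_span_pow_irreducible hmap hϖ
  have hle : (⊤ : Submodule R S) ≤ Subalgebra.toSubmodule (Algebra.adjoin R {x}) := by
    refine Submodule.le_of_le_smul_of_le_jacobson_bot (I := maximalIdeal R)
      Module.Finite.fg_top (maximalIdeal_le_jacobson ⊥) fun z _ => ?_
    obtain ⟨a, ha, hza⟩ := happrox n z
    rw [hϖ.maximalIdeal_eq, Ideal.span_singleton_pow, ← hn] at hza
    rw [← sub_add_cancel z a, add_comm]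
    refine Submodule.add_mem_sup ha ?_
    rw [Ideal.smul_top_eq_map]
    exact hza
  exact top_le_iff.mp fun z _ => hle (Submodule.mem_top (x := z))

end Monogenic

theorem maxIdeal_eq_maximalIdeal (R L : Type*) [CommRing R] [Field L] [Algebra R L]
    [IsLocalRing (ringOfInt R L)] : maxIdeal R L = IsLocalRing.maximalIdeal (ringOfInt R L) :=
  IsLocalRing.jacobson_eq_maximalIdeal ⊥ bot_ne_top

section LocalField

variable (F L : Type*) [Field F] [ValuativeRel F] [Field L] [Algebra F L]

theorem faithfulSMul_ringOfInt : FaithfulSMul 𝒪[F] (ringOfInt 𝒪[F] L) := by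
  rw [faithfulSMul_iff_algebraMap_injective]
  intro x y h
  have h' : algebraMap F L x = algebraMap F L y := congrArg Subtype.val h
  exact Subtype.ext ((algebraMap F L).injective h')

variable [TopologicalSpace F] [IsNonarchimedeanLocalField F]

theorem isLocalRing_ringOfInt [Algebra.IsAlgebraic F L] : IsLocalRing (ringOfInt 𝒪[F] L) := by
  let := IsTopologicalAddGroup.rightUniformSpace F
  have := isUniformAddGroup_of_addCommGroup (G := F)
  let : (Valued.v (R := F) (Γ₀ := ValuativeRel.ValueGroupWithZero F)).RankOne :=
  { hom' := ValuativeRel.IsRankLeOne.nonempty.some.emb (R := F).comp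
      MonoidWithZeroHom.ValueGroup₀.embedding
    strictMono' := ValuativeRel.IsRankLeOne.nonempty.some.strictMono.comp
        MonoidWithZeroHom.ValueGroup₀.embedding_strictMono }
  have hc : CompleteSpace F := inferInstance
  open scoped Valued in
  exact isLocalRing_integralClosure (A := (ValuativeRel.valuation F).integer) (K := F)
    (L := L) fun x => by
    rw [Valued.toNormedField.norm_le_one_iff]
    constructor
    · exact fun h => ⟨⟨x, h⟩, rfl⟩
    · rintro ⟨y, rfl⟩
      exact y.2

variable [FiniteDimensional F L] [Algebra.IsSeparable F L]

theorem module_finite_ringOfInt : Module.Finite 𝒪[F] (ringOfInt 𝒪[F] L) :=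
  IsIntegralClosure.finite 𝒪[F] F L (ringOfInt 𝒪[F] L)

theorem isDiscreteValuationRing_ringOfInt : IsDiscreteValuationRing (ringOfInt 𝒪[F] L) := by
  have := integralClosure.isDedekindDomain 𝒪[F] F L
  have := isLocalRing_ringOfInt F L
  have := faithfulSMul_ringOfInt F L
  have hF : ¬ IsField (ringOfInt 𝒪[F] L) := fun h => IsDiscreteValuationRing.not_isField 𝒪[F]
    (isField_of_isIntegral_of_isField (R := 𝒪[F]) (S := ringOfInt 𝒪[F] L)
      (FaithfulSMul.algebraMap_injective _ _) h)
  exact ((IsDiscreteValuationRing.TFAE _ hF).out 0 2).mpr ‹IsDedekindDomain _›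

theorem finite_residueRing : Finite (residueRing 𝒪[F] L) := by
  obtain ⟨f, hf⟩ := residueCard_eq_pow F L
  refine Nat.finite_of_card_ne_zero ?_
  change residueCard 𝒪[F] L ≠ 0
  rw [hf]
  exact pow_ne_zero _ Nat.card_pos.ne'

theorem exists_adjoin_ringOfInt_eq_top :
    ∃ x : ringOfInt 𝒪[F] L, Algebra.adjoin 𝒪[F] {x} = ⊤ := by
  have := isDiscreteValuationRing_ringOfInt F L
  have := module_finite_ringOfInt F L
  have : Finite (IsLocalRing.ResidueField (ringOfInt 𝒪[F] L)) := by
    have h := finite_residueRing F L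
    rwa [residueRing, maxIdeal_eq_maximalIdeal] at h
  have := faithfulSMul_ringOfInt F L
  exact exists_adjoin_eq_top 𝒪[F] (IsDiscreteValuationRing.not_isField 𝒪[F])

end LocalField

/-! ### Herbrand's theorem -/

section RamificationIndex

open IsLocalRing
open IsDiscreteValuationRing hiding maximalIdeal

variable {T S : Type*} [CommRing T] [IsDomain T] [IsDiscreteValuationRing T] [CommRing S]
  [IsDomain S] [IsDiscreteValuationRing S]

theorem mem_maximalIdeal_pow_iff {x : S} {n : ℕ} :
    x ∈ maximalIdeal S ^ n ↔ (n : ℕ∞) ≤ addVal S x := by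
  obtain ⟨ϖ, hϖ⟩ := exists_irreducible S
  rw [hϖ.maximalIdeal_eq, Ideal.span_singleton_pow, Ideal.mem_span_singleton, ← hϖ.addVal_pow,
    addVal_le_iff_dvd]

theorem addVal_prod {α : Type*} (s : Finset α) (f : α → S) :
    addVal S (∏ a ∈ s, f a) = ∑ a ∈ s, addVal S (f a) := by
  classical
  induction s using Finset.induction_on with
  | empty => exact addVal_one
  | insert a s ha ih => rw [Finset.prod_insert ha, Finset.sum_insert ha, addVal_mul, ih]

variable [Algebra T S] [Module.Finite T S] [FaithfulSMul T S] [Finite (ResidueField T)]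

/-- In a Galois extension of discrete valuation rings with finite residue fields, the order `e` of
the inertia group is the ramification index. -/
theorem addVal_algebraMap_eq_card_inertia_mul (G : Type*) [Group G] [Finite G]
    [MulSemiringAction G S] [IsGaloisGroup G T S] (z : T) :
    addVal S (algebraMap T S z) = Nat.card ((maximalIdeal S).inertia G) * addVal T z := by
  set e := Nat.card ((maximalIdeal S).inertia G)
  obtain ⟨ϖ, hϖ⟩ := exists_irreducible T
  have he : (maximalIdeal T).ramificationIdx' (maximalIdeal S) = e := by
    have : PerfectField (maximalIdeal T).ResidueField := by
      have : Finite (T ⧸ maximalIdeal T) := inferInstanceAs (Finite (ResidueField T))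
      exact PerfectField.ofFinite
    have : Module.Flat T S := inferInstance
    rw [Ideal.ramificationIdx'_eq_ramificationIdx,
      ← Ideal.ramificationIdxIn_eq_ramificationIdx (maximalIdeal T) (maximalIdeal S) G,
      ← Ideal.card_inertia_eq_ramificationIdxIn (G := G) (maximalIdeal T) (maximalIdeal S)]
    exact fun h => not_isField T (isField_iff_maximalIdeal_eq.mpr h)
  have hϖ0 : algebraMap T S ϖ ≠ 0 := by
    rw [Ne, FaithfulSMul.algebraMap_eq_zero_iff]
    exact hϖ.ne_zero
  have key : addVal S (algebraMap T S ϖ) = e := by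
    obtain ⟨n, hn⟩ := ENat.ne_top_iff_exists.mp fun h => hϖ0 (addVal_eq_top_iff.mp h)
    have hle (k : ℕ) :
        (maximalIdeal T).map (algebraMap T S) ≤ maximalIdeal S ^ k ↔ k ≤ n := by
      rw [hϖ.maximalIdeal_eq, Ideal.map_span, Set.image_singleton, Ideal.span_singleton_le_iff_mem,
        mem_maximalIdeal_pow_iff, ← hn, Nat.cast_le]
    rw [← hn, ← he, Ideal.ramificationIdx'_spec ((hle n).mpr le_rfl)
      fun h => (Nat.lt_succ_self n).not_ge ((hle _).mp h)]
  by_cases hz : z = 0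
  · have : e ≠ 0 := Nat.card_pos.ne'
    rw [hz, map_zero, addVal_zero, addVal_zero, ENat.mul_top (by exact_mod_cast this)]
  · obtain ⟨n, u, rfl⟩ := eq_unit_mul_pow_irreducible hz hϖ
    rw [map_mul, map_pow, addVal_mul, addVal_pow, key, addVal_def' u hϖ,
      addVal_eq_zero_iff.mpr (u.isUnit.map (algebraMap T S)), zero_add, nsmul_eq_mul, mul_comm]

end RamificationIndex

/-- The facts about the ring of integers `𝒪_L` of a finite extension of local fields that are needed
for ramification theory: it is a discrete valuation ring with quotient field `L` and finite residue
field, and it is finite and monogenic over the base. -/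
class HasLocalIntegers (R L : Type*) [CommRing R] [Field L] [Algebra R L] : Prop where
  isDiscreteValuationRing : IsDiscreteValuationRing (ringOfInt R L)
  isFractionRing : IsFractionRing (ringOfInt R L) L
  finite_residueField : Finite (IsLocalRing.ResidueField (ringOfInt R L))
  module_finite : Module.Finite R (ringOfInt R L)
  exists_adjoin_eq_top : ∃ x : ringOfInt R L, Algebra.adjoin R {x} = ⊤

theorem HasLocalIntegers.of_finiteDimensional (F L : Type*) [Field F] [ValuativeRel F]
    [TopologicalSpace F] [IsNonarchimedeanLocalField F] [Field L] [Algebra F L]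
    [FiniteDimensional F L] [Algebra.IsSeparable F L] : HasLocalIntegers 𝒪[F] L where
  isDiscreteValuationRing := isDiscreteValuationRing_ringOfInt F L
  isFractionRing := integralClosure.isFractionRing_of_finite_extension F L
  finite_residueField := by
    have := isDiscreteValuationRing_ringOfInt F L
    have h := finite_residueRing F L
    rwa [residueRing, maxIdeal_eq_maximalIdeal] at h
  module_finite := module_finite_ringOfInt F L
  exists_adjoin_eq_top := exists_adjoin_ringOfInt_eq_top F L

section Tower

open IsDiscreteValuationRing Polynomial

attribute [local instance] HasLocalIntegers.isDiscreteValuationRing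
  HasLocalIntegers.isFractionRing HasLocalIntegers.finite_residueField
  HasLocalIntegers.module_finite

variable {R K M L : Type*} [CommRing R] [Field K] [Field M] [Field L] [Algebra R K] [Algebra R M]
  [Algebra R L] [Algebra K M] [Algebra K L] [Algebra M L] [IsScalarTower R K M]
  [IsScalarTower R K L] [IsScalarTower R M L] [IsScalarTower K M L]

@[simp] theorem galInt_algebraMap (σ : Gal(L/K)) (r : R) :
    galInt R K L σ (algebraMap R _ r) = algebraMap R _ r :=
  Subtype.ext ((σ.restrictScalars R).commutes r)

/-- If `𝒪_L` is generated by `x`, the action of `σ` on `𝒪_L` is controlled by that on `x`. -/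
theorem dvd_galInt_sub {x : ringOfInt R L} (hx : Algebra.adjoin R {x} = ⊤) (σ : Gal(L/K))
    (z : ringOfInt R L) : galInt R K L σ x - x ∣ galInt R K L σ z - z := by
  have hz : z ∈ Algebra.adjoin R {x} := by rw [hx]; trivial
  induction hz using Algebra.adjoin_induction with
  | mem z hz => rw [Set.mem_singleton_iff.mp hz]
  | algebraMap r => simp
  | add a b _ _ ha hb =>
    rw [map_add, add_sub_add_comm]
    exact dvd_add ha hb
  | mul a b _ _ ha hb =>
    have h : galInt R K L σ (a * b) - a * b =
        galInt R K L σ a * (galInt R K L σ b - b) + (galInt R K L σ a - a) * b := by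
      rw [map_mul]
      ring
    rw [h]
    exact dvd_add (dvd_mul_of_dvd_right hb _) (dvd_mul_of_dvd_left ha _)

theorem eq_one_of_galInt_eq [IsFractionRing (ringOfInt R L) L] {x : ringOfInt R L}
    (hx : Algebra.adjoin R {x} = ⊤) {σ : Gal(L/K)} (h : galInt R K L σ x = x) : σ = 1 := by
  have hz (z : ringOfInt R L) : σ (z : L) = z := by
    have := dvd_galInt_sub hx σ z
    rw [h, sub_self, zero_dvd_iff, sub_eq_zero] at this
    exact congrArg Subtype.val this
  refine AlgEquiv.ext fun l => ?_
  obtain ⟨a, b, -, rfl⟩ := IsFractionRing.div_surjective (A := ringOfInt R L) l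
  rw [map_div₀]
  exact congrArg₂ (· / ·) (hz a) (hz b)

theorem depth_eq_addVal [HasLocalIntegers R L] {x : ringOfInt R L}
    (hx : Algebra.adjoin R {x} = ⊤) (σ : Gal(L/K)) :
    depth R K σ = addVal _ (galInt R K L σ x - x) := by
  refine ENat.eq_of_forall_natCast_le_iff fun n => ?_
  simp_rw [natCast_le_depth_iff, maxIdeal_eq_maximalIdeal, mem_maximalIdeal_pow_iff]
  exact ⟨fun h => h x, fun h z => h.trans (addVal_le_iff_dvd.mpr (dvd_galInt_sub hx σ z))⟩

theorem depth_eq_top_iff [HasLocalIntegers R L] {σ : Gal(L/K)} : depth R K σ = ⊤ ↔ σ = 1 := by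
  obtain ⟨x, hx⟩ := HasLocalIntegers.exists_adjoin_eq_top (R := R) (L := L)
  refine ⟨fun h => ?_, fun h => h ▸ depth_one⟩
  rw [depth_eq_addVal hx, addVal_eq_top_iff, sub_eq_zero] at h
  exact eq_one_of_galInt_eq hx h

/-- The inclusion of `𝒪_M` in `𝒪_L`. -/
def ringOfIntMap (R M L : Type*) [CommRing R] [Field M] [Field L] [Algebra R M] [Algebra R L]
    [Algebra M L] [IsScalarTower R M L] : ringOfInt R M →ₐ[R] ringOfInt R L :=
  (IsScalarTower.toAlgHom R M L).mapIntegralClosure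

theorem ringOfIntMap_injective : Function.Injective (ringOfIntMap R M L) := fun _ _ h =>
  Subtype.ext ((algebraMap M L).injective (congrArg Subtype.val h))

theorem ringOfIntMap_galInt [Normal K M] (σ : Gal(L/K)) (z : ringOfInt R M) :
    ringOfIntMap R M L (galInt R K M (AlgEquiv.restrictNormalHom M σ) z) =
      galInt R K L σ (ringOfIntMap R M L z) :=
  Subtype.ext (σ.restrictNormal_commutes M z)

theorem galInt_ringOfIntMap (τ : Gal(L/M)) (z : ringOfInt R M) :
    galInt R M L τ (ringOfIntMap R M L z) = ringOfIntMap R M L z :=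
  Subtype.ext (τ.commutes z)

theorem exists_ringOfIntMap_eq [FiniteDimensional M L] [IsGalois M L] {z : ringOfInt R L}
    (hz : ∀ τ : Gal(L/M), galInt R M L τ z = z) : ∃ w, ringOfIntMap R M L w = z := by
  obtain ⟨w, hw⟩ := (IsGalois.mem_range_algebraMap_iff_fixed (F := M) (z : L)).mpr
    fun τ => congrArg Subtype.val (hz τ)
  refine ⟨⟨w, ?_⟩, Subtype.ext hw⟩
  have h : IsIntegral R (algebraMap M L w) := hw ▸ z.2
  exact (isIntegral_algebraMap_iff (algebraMap M L).injective).mp h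

variable (K) in
theorem restrictNormalHom_restrictScalars [Normal K M] (τ : Gal(L/M)) :
    AlgEquiv.restrictNormalHom M (AlgEquiv.restrictScalarsHom K τ) = 1 :=
  AlgEquiv.ext fun m => (algebraMap M L).injective
    ((AlgEquiv.restrictNormal_commutes (τ.restrictScalars K) M m).trans (τ.commutes m))

theorem exists_restrictScalars_eq [Normal K M] {σ : Gal(L/K)}
    (h : AlgEquiv.restrictNormalHom M σ = 1) :
    ∃ τ : Gal(L/M), AlgEquiv.restrictScalarsHom K τ = σ :=
  ⟨AlgEquiv.ofRingEquiv (f := (σ : L ≃+* L)) fun m => by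
    have := AlgEquiv.restrictNormal_commutes σ M m
    rw [show σ.restrictNormal M = 1 from h] at this
    exact this.symm, rfl⟩

theorem sum_fiber_eq_sum [FiniteDimensional K L] [FiniteDimensional M L] [Normal K M]
    [DecidableEq Gal(M/K)] {N : Type*} [AddCommMonoid N] (f : Gal(L/K) → N) (σ : Gal(L/K)) :
    ∑ s with AlgEquiv.restrictNormalHom M s = AlgEquiv.restrictNormalHom M σ, f s =
      ∑ τ : Gal(L/M), f (σ * AlgEquiv.restrictScalarsHom K τ) := by
  rw [sum_fiber_eq]
  symm
  refine Finset.sum_bij (fun τ _ => AlgEquiv.restrictScalarsHom K τ) (fun τ _ => ?_)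
    (fun τ _ τ' _ h => ?_) (fun s hs => ?_) fun _ _ => rfl
  · simpa using restrictNormalHom_restrictScalars K τ
  · exact AlgEquiv.restrictScalars_injective K h
  · obtain ⟨τ, rfl⟩ := exists_restrictScalars_eq (by simpa using hs)
    exact ⟨τ, Finset.mem_univ _, rfl⟩

/-- The fundamental relation between the ramification of `L/K` and of `M/K`: if `𝒪_L` and `𝒪_M` are
generated by `x` and `y`, then `σ y - y` agrees up to a unit with the product of the `s x - x`, where
`s` runs through the elements of `Gal(L/K)` with the same restriction to `M` as `σ`. Both are compared
with the value at `x` of the image under `σ` of the polynomial `∏ (X - τ x)`, `τ ∈ Gal(L/M)`. -/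
theorem associated_galInt_sub [FiniteDimensional M L] [IsGalois M L] [Normal K M]
    [HasLocalIntegers R L] {x : ringOfInt R L} (hx : Algebra.adjoin R {x} = ⊤) {y : ringOfInt R M}
    (hy : Algebra.adjoin R {y} = ⊤) (σ : Gal(L/K)) :
    Associated (ringOfIntMap R M L (galInt R K M (AlgEquiv.restrictNormalHom M σ) y - y))
      (∏ τ : Gal(L/M), (galInt R K L (σ * AlgEquiv.restrictScalarsHom K τ) x - x)) := by
  set g : ringOfInt R L →+* ringOfInt R L := (galInt R K L σ : ringOfInt R L →+* ringOfInt R L)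
  let P : (ringOfInt R L)[X] := ∏ τ : Gal(L/M), (X - C (galInt R M L τ x))
  have hPg : Associated ((P.map g).eval x)
      (∏ τ : Gal(L/M), (galInt R K L (σ * AlgEquiv.restrictScalarsHom K τ) x - x)) := by
    rw [Polynomial.map_prod, eval_prod]
    refine Associated.prod _ _ _ fun τ _ => ?_
    rw [Polynomial.map_sub, map_X, map_C, eval_sub, eval_X, eval_C, ← neg_sub]
    exact Associated.neg_left (Associated.refl _)
  refine Associated.trans ?_ hPg
  refine associated_of_dvd_dvd ?_ ?_
  · -- The coefficients of `P` lie in `𝒪_M`, and `x` is a root of `P`.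
    have hroot : P.eval x = 0 := by
      rw [eval_prod]
      refine Finset.prod_eq_zero (Finset.mem_univ 1) ?_
      simp
    have hcoeff (n : ℕ) : ∃ c, ringOfIntMap R M L c = P.coeff n := by
      refine exists_ringOfIntMap_eq fun τ => ?_
      have : P.map (galInt R M L τ : ringOfInt R L →+* ringOfInt R L) = P := by
        rw [Polynomial.map_prod]
        refine Fintype.prod_equiv (Equiv.mulLeft τ) _ _ fun τ' => ?_
        rw [Polynomial.map_sub, map_X, map_C, Equiv.coe_mulLeft, map_mul]
        rfl
      conv_rhs => rw [← this, coeff_map]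
      rfl
    rw [← sub_zero (eval _ _), ← hroot, ← eval_sub]
    have hdvd : C (ringOfIntMap R M L (galInt R K M (AlgEquiv.restrictNormalHom M σ) y - y)) ∣
        P.map g - P := by
      rw [C_dvd_iff_dvd_coeff]
      intro n
      obtain ⟨c, hc⟩ := hcoeff n
      rw [coeff_sub, coeff_map, ← hc]
      change _ ∣ galInt R K L σ _ - _
      rw [← ringOfIntMap_galInt, ← map_sub]
      exact map_dvd _ (dvd_galInt_sub hy _ c)
    have := map_dvd (evalRingHom x) hdvd
    simpa only [coe_evalRingHom, eval_C] using this
  · -- If `y = q(x)`, then all `τ x` are roots of `q - y`, so that `P` divides `q - y`.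
    have hy' : ringOfIntMap R M L y ∈ Algebra.adjoin R {x} := by rw [hx]; trivial
    rw [Algebra.adjoin_singleton_eq_range_aeval] at hy'
    obtain ⟨q, hq⟩ := hy'
    replace hq : aeval x q = ringOfIntMap R M L y := hq
    have hdvd : P ∣ q.map (algebraMap R _) - C (ringOfIntMap R M L y) := by
      by_cases h0 : q.map (algebraMap R _) - C (ringOfIntMap R M L y) = 0
      · rw [h0]
        exact dvd_zero _
      have hP : P = (((Finset.univ : Finset Gal(L/M)).val.map fun τ => galInt R M L τ x).map
          fun a => X - C a).prod := by
        rw [Multiset.map_map]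
        rfl
      rw [hP, Multiset.prod_X_sub_C_dvd_iff_le_roots h0, Multiset.le_iff_subset]
      · intro z hz
        obtain ⟨τ, -, rfl⟩ := Multiset.mem_map.mp hz
        rw [mem_roots h0, IsRoot, eval_sub, eval_C, eval_map_algebraMap, sub_eq_zero,
          ← galInt_ringOfIntMap τ y, ← hq]
        have := aeval_algHom_apply (A := ringOfInt R L) (B := ringOfInt R L)
          (⟨(galInt R M L τ : ringOfInt R L →+* ringOfInt R L), galInt_algebraMap τ⟩ :
            ringOfInt R L →ₐ[R] ringOfInt R L) x q
        exact this
      · refine Multiset.Nodup.map (fun τ τ' h => ?_) Finset.univ.nodup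
        have : galInt R M L (τ'⁻¹ * τ) x = x := by
          rw [map_mul, RingAut.mul_apply, show galInt R M L τ x = galInt R M L τ' x from h,
            ← RingAut.mul_apply, ← map_mul, inv_mul_cancel, map_one, RingAut.one_apply]
        exact (inv_mul_eq_one.mp (eq_one_of_galInt_eq hx this)).symm
    have := map_dvd (evalRingHom x) (map_dvd (mapRingHom g) hdvd)
    have hg : g.comp (algebraMap R _) = algebraMap R _ := RingHom.ext (galInt_algebraMap σ)
    rw [coe_evalRingHom, coe_mapRingHom, Polynomial.map_sub, map_map, hg, map_C,
      eval_sub, eval_C, eval_map_algebraMap, hq] at this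
    rw [← dvd_neg, ← map_neg, neg_sub, map_sub, ringOfIntMap_galInt]
    exact this

/-- The valuation of `L` restricts to `e` times that of `M`, for the order `e` of the inertia group. -/
theorem addVal_ringOfIntMap [FiniteDimensional M L] [IsGalois M L] [HasLocalIntegers R M]
    [HasLocalIntegers R L] (z : ringOfInt R M) :
    addVal _ (ringOfIntMap R M L z) = Nat.card (lowerRam R M L 0) * addVal _ z := by
  let _ : Algebra (ringOfInt R M) (ringOfInt R L) := (ringOfIntMap R M L).toRingHom.toAlgebra
  have : IsScalarTower R (ringOfInt R M) (ringOfInt R L) :=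
    .of_algebraMap_eq fun r => ((ringOfIntMap R M L).commutes r).symm
  have : Module.Finite (ringOfInt R M) (ringOfInt R L) := .of_restrictScalars_finite R _ _
  have : FaithfulSMul (ringOfInt R M) (ringOfInt R L) :=
    (faithfulSMul_iff_algebraMap_injective _ _).mpr ringOfIntMap_injective
  let _ : MulSemiringAction Gal(L/M) (ringOfInt R L) := .compHom _ (galInt R M L)
  obtain ⟨x, hx⟩ := HasLocalIntegers.exists_adjoin_eq_top (R := R) (L := L)
  have : IsGaloisGroup Gal(L/M) (ringOfInt R M) (ringOfInt R L) :=
    { faithful := ⟨fun {τ τ'} h => by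
        have h' : galInt R M L τ x = galInt R M L τ' x := h x
        have : galInt R M L (τ'⁻¹ * τ) x = x := by
          rw [map_mul, RingAut.mul_apply, h', ← RingAut.mul_apply, ← map_mul, inv_mul_cancel,
            map_one, RingAut.one_apply]
        exact (inv_mul_eq_one.mp (eq_one_of_galInt_eq hx this)).symm⟩
      commutes := ⟨fun τ a b => by
        rw [Algebra.smul_def, Algebra.smul_def, smul_mul']
        exact congrArg (· * _) (galInt_ringOfIntMap τ a)⟩
      isInvariant := ⟨fun _ h => exists_ringOfIntMap_eq h⟩ }
  have h := addVal_algebraMap_eq_card_inertia_mul (T := ringOfInt R M) (S := ringOfInt R L)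
    Gal(L/M) z
  have h0 : (IsLocalRing.maximalIdeal (ringOfInt R L)).inertia Gal(L/M) = lowerRam R M L 0 := by
    ext τ
    change (∀ z, galInt R M L τ z - z ∈ _) ↔
      ∀ z, galInt R M L τ z - z ∈ maxIdeal R L ^ (⌈(0 : ℝ)⌉ + 1).toNat
    simp [maxIdeal_eq_maximalIdeal]
  rw [h0] at h
  exact h

variable [FiniteDimensional K L] [FiniteDimensional M L] [IsGalois K L]
  [IsGalois K M] [HasLocalIntegers R M] [HasLocalIntegers R L]

variable (R K M L) in
open Classical in
theorem isRamificationTower :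
    IsRamificationTower (AlgEquiv.restrictNormalHom M : Gal(L/K) →* Gal(M/K)) (depth R K)
      (Nat.card (lowerRam R M L 0)) (depth R K) where
  surjective := AlgEquiv.restrictNormalHom_surjective L
  le_mul := min_depth_le
  inv := depth_inv
  eq_top_iff _ := depth_eq_top_iff
  eq_top_iff' _ := depth_eq_top_iff
  ne_zero := Nat.card_pos.ne'
  sum_fiber σ := by
    have := IsGalois.tower_top_of_isGalois K M L
    obtain ⟨σ, rfl⟩ := AlgEquiv.restrictNormalHom_surjective (F := K) (K₁ := M) L σ
    obtain ⟨x, hx⟩ := HasLocalIntegers.exists_adjoin_eq_top (R := R) (L := L)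
    obtain ⟨y, hy⟩ := HasLocalIntegers.exists_adjoin_eq_top (R := R) (L := M)
    rw [sum_fiber_eq_sum (M := M) (depth R K) σ, depth_eq_addVal hy, ← addVal_ringOfIntMap,
      (addVal_eq_iff_associated _ _).mpr (associated_galInt_sub hx hy σ), addVal_prod]
    exact Finset.sum_congr rfl fun τ _ => (depth_eq_addVal hx _).symm

variable (R K M L) in
open Classical in
set_option linter.unusedSectionVars false in
theorem kerSum_eq {u : ℝ} (hu : 0 ≤ u) :
    kerSum (AlgEquiv.restrictNormalHom M : Gal(L/K) →* Gal(M/K)) (depth R K)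
      (Nat.card (lowerRam R M L 0)) (u + 1) = herbrandPhi R M L u + 1 := by
  rw [herbrandPhi_add_one hu, kerSum]
  have h := sum_fiber_eq_sum (M := M) (fun s => truncMin (depth R K s) (u + 1)) (1 : Gal(L/K))
  simp only [map_one, one_mul] at h
  rw [h]
  rfl

/-- Herbrand's theorem, in the lower numbering: the image of `Gal(L/K)_u` in `Gal(M/K)` is the
ramification group with index `φ_{L/M}(u)`. -/
theorem map_lowerRam {u : ℝ} (hu : 0 ≤ u) :
    (lowerRam R K L u).map (AlgEquiv.restrictNormalHom M) =
      lowerRam R K M (herbrandPhi R M L u) := by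
  classical
  ext σ
  rw [mem_lowerRam_iff, ← kerSum_eq R K M L hu,
    ← (isRamificationTower R K M L).exists_fiber_truncMin_eq_iff, Subgroup.mem_map]
  simp_rw [mem_lowerRam_iff, and_comm]

variable [FiniteDimensional K M]

/-- Transitivity of the Hasse-Herbrand functions. -/
theorem herbrandPhi_comp {u : ℝ} (hu : 0 ≤ u) :
    herbrandPhi R K M (herbrandPhi R M L u) = herbrandPhi R K L u := by
  classical
  have := IsGalois.tower_top_of_isGalois K M L
  have h := isRamificationTower R K M L
  have he : (Nat.card (lowerRam R M L 0) : ℝ) ≠ 0 := (card_lowerRam_pos 0).ne'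
  -- The sum over `Gal(L/K)` is computed fibre by fibre, for a general `u` and for `u = 0`.
  have key {u : ℝ} (hu : 0 ≤ u) : ∑ s : Gal(L/K), truncMin (depth R K s) (u + 1) =
      Nat.card (lowerRam R M L 0) *
        ∑ σ : Gal(M/K), truncMin (depth R K σ) (herbrandPhi R M L u + 1) := by
    rw [Finset.mul_sum, ← kerSum_eq R K M L hu,
      ← Finset.sum_fiberwise Finset.univ (AlgEquiv.restrictNormalHom M : Gal(L/K) →* Gal(M/K))]
    exact Finset.sum_congr rfl fun σ _ => h.sum_fiber_truncMin σ _
  have h0 := key le_rfl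
  rw [herbrandPhi_zero, zero_add, sum_truncMin_depth_one, sum_truncMin_depth_one] at h0
  rw [← add_left_inj (1 : ℝ), herbrandPhi_add_one hu, herbrandPhi_add_one (herbrandPhi_nonneg hu),
    key hu, h0, mul_div_mul_left _ _ he]

theorem herbrandPsi_comp {v : ℝ} (hv : 0 ≤ v) :
    herbrandPsi R M L (herbrandPsi R K M v) = herbrandPsi R K L v := by
  have h0 := herbrandPsi_nonneg (R := R) (K := K) (L := M) hv
  rw [← herbrandPhi_strictMono (R := R) (K := K) (L := L).injective.eq_iff,
    ← herbrandPhi_comp (M := M) (herbrandPsi_nonneg h0), herbrandPhi_herbrandPsi h0,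
    herbrandPhi_herbrandPsi hv, herbrandPhi_herbrandPsi hv]

/-- Herbrand's theorem: the upper numbering is compatible with quotients. -/
theorem map_upperRam {v : ℝ} (hv : 0 ≤ v) :
    (upperRam R K L v).map (AlgEquiv.restrictNormalHom M) = upperRam R K M v := by
  have h0 := herbrandPsi_nonneg (R := R) (K := K) (L := M) hv
  rw [upperRam, map_lowerRam (herbrandPsi_nonneg hv), upperRam, ← herbrandPsi_comp (M := M) hv,
    herbrandPhi_herbrandPsi h0]

/-- The intersection of `Gal(L/K)^v` with `Gal(L/M)`. -/
theorem restrictScalars_mem_upperRam_iff {v : ℝ} (hv : 0 ≤ v) (τ : Gal(L/M)) :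
    AlgEquiv.restrictScalarsHom K τ ∈ upperRam R K L v ↔
      τ ∈ upperRam R M L (herbrandPsi R K M v) := by
  rw [upperRam, upperRam, herbrandPsi_comp hv]
  rfl

end Tower

/-! ### The Weil group of an extension as an open subgroup -/

section Frobenius

theorem dvd_of_forall_pow_eq {k : Type*} [Field k] [Finite k] {q f m : ℕ} (hq : Nat.card k = q ^ f)
    (h : ∀ a : k, a ^ q ^ m = a) : f ∣ m := by
  obtain ⟨g, hg⟩ := IsCyclic.exists_ofOrder_eq_natCard (α := kˣ)
  have := Fintype.ofFinite k
  have hcard : Nat.card kˣ = q ^ f - 1 := by rw [Nat.card_units, hq]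
  have h1 : 1 < q ^ f := hq ▸ Finite.one_lt_card
  have hf : f ≠ 0 := by rintro rfl; simp at h1
  have hq1 : 1 < q := (Nat.one_lt_pow_iff hf).mp h1
  have hgm : g ^ (q ^ m - 1) = 1 := by
    have : g ^ (q ^ m) = g := Units.ext (by rw [Units.val_pow_eq_pow_val, h])
    rw [pow_sub g (Nat.one_le_pow _ _ (by omega)), this, pow_one, mul_inv_cancel]
  have hdvd : q ^ f - 1 ∣ q ^ m - 1 := by
    rw [← hcard, ← hg]
    exact orderOf_dvd_of_pow_eq_one hgm
  have h2 := Nat.pow_sub_one_gcd_pow_sub_one q f m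
  rw [Nat.gcd_eq_left hdvd] at h2
  have h3 : q ^ f = q ^ f.gcd m := by
    have := Nat.one_le_pow (f.gcd m) q (by omega)
    omega
  rw [Nat.pow_right_injective hq1 h3]
  exact Nat.gcd_dvd_right f m

/-- An integral power of the Frobenius `x ↦ x ^ q` of a ring containing the field with `q ^ f`
elements is a power of `x ↦ x ^ (q ^ f)` if it is trivial on this field. -/
theorem mem_closure_frobenius {k A : Type*} [CommRing k] (hk : IsField k) [Finite k] [CommRing A]
    [Nontrivial A] (j : k →+* A) {q f : ℕ} (hq : Nat.card k = q ^ f) {φ : RingAut A}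
    (hφ : φ ∈ Subgroup.closure {φ : RingAut A | ∀ x, φ x = x ^ q}) (hφj : ∀ a, φ (j a) = j a) :
    φ ∈ Subgroup.closure {φ : RingAut A | ∀ x, φ x = x ^ q ^ f} := by
  let _ := hk.toField
  have hj : Function.Injective j := RingHom.injective j
  by_cases hne : ∃ Fr : RingAut A, ∀ x, Fr x = x ^ q
  · obtain ⟨Fr, hFr⟩ := hne
    have hpow (n : ℕ) (x : A) : (Fr ^ n) x = x ^ q ^ n := by
      induction n with
      | zero => simp
      | succ n ih => rw [pow_succ', RingAut.mul_apply, hFr, ih, ← pow_mul, pow_succ]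
    have hset : {φ : RingAut A | ∀ x, φ x = x ^ q} = {Fr} := by
      ext φ'
      exact ⟨fun h => RingEquiv.ext fun x => (h x).trans (hFr x).symm, fun h => h ▸ hFr⟩
    rw [hset, Subgroup.mem_closure_singleton] at hφ
    obtain ⟨n, rfl⟩ := hφ
    have habs (a : k) : (Fr ^ n.natAbs) (j a) = j a := by
      rcases Int.natAbs_eq n with h | h
      · rw [h, zpow_natCast] at hφj
        exact hφj a
      · rw [h, zpow_neg, zpow_natCast] at hφj
        conv_lhs => rw [← hφj a]
        rw [← RingAut.mul_apply, mul_inv_cancel, RingAut.one_apply]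
    have hdvd : (f : ℤ) ∣ n := Int.natCast_dvd.mpr (dvd_of_forall_pow_eq hq fun a =>
      hj (by rw [map_pow, ← hpow, habs]))
    obtain ⟨m, rfl⟩ := hdvd
    rw [zpow_mul, zpow_natCast]
    have hmem : Fr ^ f ∈ {φ : RingAut A | ∀ x, φ x = x ^ q ^ f} := hpow f
    exact zpow_mem (Subgroup.subset_closure hmem) m
  · have hset : {φ : RingAut A | ∀ x, φ x = x ^ q} = ∅ :=
      Set.eq_empty_of_forall_notMem fun φ h => hne ⟨φ, h⟩
    rw [hset, Subgroup.closure_empty, Subgroup.mem_bot] at hφ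
    rw [hφ]
    exact one_mem _

end Frobenius

section Krull

variable (F E Ω : Type*) [Field F] [Field E] [Algebra F E] [Field Ω] [Algebra F Ω] [Algebra E Ω]
  [IsScalarTower F E Ω]

theorem isInducing_restrictScalarsHom [IsGalois F Ω] :
    Topology.IsInducing (AlgEquiv.restrictScalarsHom F : Gal(Ω/E) →* Gal(Ω/F)) := by
  have : IsGalois E Ω := .tower_top_of_isGalois F E Ω
  exact ((continuous_restrictScalarsHom F E Ω).isClosedEmbedding
    (AlgEquiv.restrictScalars_injective F)).isInducing

theorem isOpen_range_restrictScalarsHom [FiniteDimensional F E] :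
    IsOpen ((AlgEquiv.restrictScalarsHom F : Gal(Ω/E) →* Gal(Ω/F)).range : Set Gal(Ω/F)) := by
  have : FiniteDimensional F (IsScalarTower.toAlgHom F E Ω).fieldRange :=
    (AlgEquiv.ofInjectiveField (IsScalarTower.toAlgHom F E Ω)).toLinearEquiv.finiteDimensional
  convert! (IsScalarTower.toAlgHom F E Ω).fieldRange.fixingSubgroup_isOpen
  ext σ
  constructor
  · rintro ⟨τ, rfl⟩ ⟨-, e, rfl⟩
    exact τ.commutes e
  · intro h
    exact ⟨AlgEquiv.ofRingEquiv (f := (σ : Ω ≃+* Ω)) fun e => h ⟨_, e, rfl⟩, rfl⟩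

end Krull

section Inclusion

variable (F E Ω : Type*) [Field F] [ValuativeRel F] [Field E] [Algebra F E] [Field Ω] [Algebra F Ω]
  [Algebra E Ω] [IsScalarTower F E Ω]

theorem maxIdeal_le_comap_ringOfIntMap :
    maxIdeal 𝒪[F] E ≤ (maxIdeal 𝒪[F] Ω).comap (ringOfIntMap 𝒪[F] E Ω) := by
  let _ : Algebra (ringOfInt 𝒪[F] E) (ringOfInt 𝒪[F] Ω) :=
    (ringOfIntMap 𝒪[F] E Ω).toRingHom.toAlgebra
  have : IsScalarTower 𝒪[F] (ringOfInt 𝒪[F] E) (ringOfInt 𝒪[F] Ω) :=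
    .of_algebraMap_eq fun r => ((ringOfIntMap 𝒪[F] E Ω).commutes r).symm
  have : Algebra.IsIntegral (ringOfInt 𝒪[F] E) (ringOfInt 𝒪[F] Ω) := .tower_top 𝒪[F]
  intro x hx
  rw [Ideal.mem_comap]
  refine Submodule.mem_sInf.mpr ?_
  rintro J ⟨-, hJ⟩
  have := Ideal.isMaximal_comap_of_isIntegral_of_isMaximal (R := ringOfInt 𝒪[F] E) J
  exact Submodule.mem_sInf.mp hx _ ⟨bot_le, this⟩

/-- The inclusion of residue fields. -/
def residueRingMap : residueRing 𝒪[F] E →+* residueRing 𝒪[F] Ω :=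
  Ideal.quotientMap _ _ (maxIdeal_le_comap_ringOfIntMap F E Ω)

variable [TopologicalSpace F] [IsNonarchimedeanLocalField F] [FiniteDimensional F E]
  [Algebra.IsSeparable F E]

theorem weilIncl_toGal (w : WeilGroup 𝒪[F] E Ω) : WeilGroup.toGal 𝒪[F] F Ω (weilIncl F E Ω w) =
    AlgEquiv.restrictScalarsHom F (WeilGroup.toGal 𝒪[F] E Ω w) := rfl

theorem weilIncl_injective : Function.Injective (weilIncl F E Ω) := fun _ _ h =>
  Subtype.ext (AlgEquiv.restrictScalars_injective F (congrArg Subtype.val h))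

/-- An element of `W_F` which fixes `E` belongs to `W_E`. -/
theorem range_weilIncl : (weilIncl F E Ω).range =
    (AlgEquiv.restrictScalarsHom F : Gal(Ω/E) →* Gal(Ω/F)).range.comap
      (WeilGroup.toGal 𝒪[F] F Ω) := by
  refine le_antisymm ?_ fun x hx => ?_
  · rintro - ⟨w, rfl⟩
    exact ⟨_, (weilIncl_toGal F E Ω w).symm⟩
  obtain ⟨σ, hσ⟩ := hx
  suffices h : σ ∈ weilSubgroup 𝒪[F] E Ω from ⟨⟨σ, h⟩, Subtype.ext hσ⟩
  have hxmem : galResidue 𝒪[F] E Ω σ ∈ Subgroup.closure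
      {φ : RingAut (residueRing 𝒪[F] Ω) | ∀ x, φ x = x ^ residueCard 𝒪[F] F} := by
    have h2 : AlgEquiv.restrictScalarsHom F σ ∈ weilSubgroup 𝒪[F] F Ω := by rw [hσ]; exact x.2
    exact h2
  rw [residueCard_self] at hxmem
  obtain ⟨f, hf⟩ := residueCard_eq_pow F E
  have hloc := isLocalRing_ringOfInt F E
  have hfield : IsField (residueRing 𝒪[F] E) := by
    have : (maxIdeal 𝒪[F] E).IsMaximal := by rw [maxIdeal_eq_maximalIdeal]; infer_instance
    exact (Ideal.Quotient.maximal_ideal_iff_isField_quotient _).mp this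
  have : Finite (residueRing 𝒪[F] E) := finite_residueRing F E
  have : Nontrivial (residueRing 𝒪[F] Ω) := by
    refine Ideal.Quotient.nontrivial_iff.mpr fun h => ?_
    rw [Ideal.jacobson_eq_top_iff] at h
    exact bot_ne_top h
  change galResidue 𝒪[F] E Ω σ ∈ Subgroup.closure
    {φ : RingAut (residueRing 𝒪[F] Ω) | ∀ x, φ x = x ^ residueCard 𝒪[F] E}
  rw [hf]
  refine mem_closure_frobenius hfield (residueRingMap F E Ω) hf hxmem fun a => ?_
  obtain ⟨a, rfl⟩ := Ideal.Quotient.mk_surjective a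
  exact congrArg (Ideal.Quotient.mk _) (galInt_ringOfIntMap σ a)

variable [IsSepClosure F Ω]

theorem isInducing_weilIncl : Topology.IsInducing (weilIncl F E Ω) := by
  refine ⟨?_⟩
  change TopologicalSpace.induced _ _ ⊓ _ = TopologicalSpace.induced _ (_ ⊓ _)
  rw [induced_inf, induced_compose, induced_compose, (isInducing_restrictScalarsHom F E Ω).eq_induced,
    induced_compose]
  rfl

theorem isOpenMap_weilIncl : IsOpenMap (weilIncl F E Ω) := by
  refine (isInducing_weilIncl F E Ω).isOpenMap ?_
  rw [← MonoidHom.coe_range, range_weilIncl]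
  exact (isOpen_range_restrictScalarsHom F E Ω).preimage (continuous_toGal 𝒪[F] F Ω)

theorem finiteIndex_range_weilIncl : (weilIncl F E Ω).range.FiniteIndex := by
  have : (AlgEquiv.restrictScalarsHom F : Gal(Ω/E) →* Gal(Ω/F)).range.FiniteIndex := by
    have := Subgroup.quotient_finite_of_isOpen _ (isOpen_range_restrictScalarsHom F E Ω)
    exact Subgroup.finiteIndex_of_finite_quotient
  rw [range_weilIncl]
  exact ⟨by
    rw [Subgroup.index_comap]
    exact Subgroup.isFiniteRelIndex_of_finiteIndex.relIndex_ne_zero⟩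

end Inclusion

/-! ### Shapiro's lemma for nonabelian continuous cohomology -/

section Shapiro

variable {𝔤 A : Type*} [Group 𝔤] [TopologicalSpace 𝔤] [Group A] [MulDistribMulAction 𝔤 A]

namespace Cocycle

theorem map_one (a : Cocycle 𝔤 A) : a 1 = 1 := by
  have h := a.map_mul 1 1
  rw [one_smul, mul_one] at h
  exact left_eq_mul.mp h

/-- The open subgroup on which a cocycle is trivial. -/
def ker (a : Cocycle 𝔤 A) : OpenSubgroup 𝔤 where
  carrier := {g | a g = 1}
  one_mem' := a.map_one
  mul_mem' {g h} hg hh := by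
    rw [Set.mem_ofPred_eq] at *
    rw [a.map_mul, hg, hh, smul_one, one_mul]
  inv_mem' {g} hg := by
    rw [Set.mem_ofPred_eq] at *
    have h := a.map_mul g⁻¹ g
    rwa [inv_mul_cancel, a.map_one, hg, smul_one, mul_one, eq_comm] at h
  isOpen' := a.isLocallyConstant.isOpen_fiber 1

theorem map_mul_of_mem_ker (a : Cocycle 𝔤 A) (g : 𝔤) {u : 𝔤} (hu : u ∈ a.ker) :
    a (g * u) = a g := by
  rw [a.map_mul, show a u = 1 from hu, smul_one, mul_one]

end Cocycle

variable {𝔥 B : Type*} [Group 𝔥] [Group B] [MulDistribMulAction 𝔥 B]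

/-- The `𝔤`-group `A` is coinduced from the `𝔥`-group `B` along `ι`, by means of the evaluation
`ev : A → B`: sending `a` to the function `x ↦ ev (x • a)` identifies `A` with the `𝔥`-equivariant
functions on `𝔤` which are constant on the left cosets of some open subgroup. -/
structure IsCoinduced (ι : 𝔥 →* 𝔤) (ev : A →* B) : Prop where
  map_smul : ∀ w a, ev (ι w • a) = w • ev a
  ext : ∀ a a', (∀ x : 𝔤, ev (x • a) = ev (x • a')) → a = a'
  exists_eq : ∀ f : 𝔤 → B, (∀ w x, f (ι w * x) = w • f x) →
    (∃ U : OpenSubgroup 𝔤, ∀ y, ∀ u ∈ U, f (y * u) = f y) → ∃ a, ∀ x, ev (x • a) = f x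

namespace IsCoinduced

variable {ι : 𝔥 →* 𝔤} {ev : A →* B} [TopologicalSpace 𝔥]

/-- The Shapiro map on cocycles: restriction to `𝔥`, followed by the evaluation. -/
def cocycleMap (h : IsCoinduced ι ev) (hι : Continuous ι) (a : Cocycle 𝔤 A) : Cocycle 𝔥 B where
  toFun w := ev (a (ι w))
  isLocallyConstant := (a.isLocallyConstant.comp_continuous hι).comp ev
  map_mul g g' := by rw [map_mul, a.map_mul, map_mul, h.map_smul]

/-- The Shapiro map on cohomology classes. -/
def h1Map (h : IsCoinduced ι ev) (hι : Continuous ι) : H1 𝔤 A → H1 𝔥 B :=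
  Quotient.map (h.cocycleMap hι) (by
    rintro a b ⟨m, hm⟩
    exact ⟨ev m, fun x => by
      change ev (b (ι x)) = _ * ev (a (ι x)) * _
      rw [hm, map_mul, map_mul, map_inv, h.map_smul]⟩)

theorem h1Map_one (h : IsCoinduced ι ev) (hι : Continuous ι) : h.h1Map hι 1 = 1 :=
  Quotient.sound ⟨1, fun w => by
    change (1 : B) = 1⁻¹ * ev 1 * w • (1 : B)
    simp⟩

theorem h1Map_injective (h : IsCoinduced ι ev) (hι : Continuous ι) :
    Function.Injective (h.h1Map hι) := by
  intro x x' hx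
  induction x, x' using Quotient.inductionOn₂ with | _ a a'
  obtain ⟨m, hm⟩ := Quotient.exact hx
  replace hm : ∀ w, ev (a' (ι w)) = m⁻¹ * ev (a (ι w)) * w • m := hm
  -- Evaluating the relation `a' g = M⁻¹ * a g * g • M` shows that `M` has to be this function.
  obtain ⟨M, hM⟩ := h.exists_eq (fun g => (ev (a g))⁻¹ * m * ev (a' g))
    (fun w x => by
      rw [a.map_mul, a'.map_mul, map_mul, map_mul, h.map_smul, h.map_smul, hm, smul_mul', smul_mul',
        smul_inv']
      group)
    ⟨a.ker ⊓ a'.ker, fun y u hu => by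
      rw [a.map_mul_of_mem_ker y hu.1, a'.map_mul_of_mem_ker y hu.2]⟩
  refine Quotient.sound ⟨M, fun g => h.ext _ _ fun x => ?_⟩
  rw [smul_mul', smul_mul', map_mul, map_mul, smul_inv', map_inv, hM, ← mul_smul, hM, a.map_mul,
    a'.map_mul, map_mul, map_mul]
  group

theorem h1Map_surjective [IsTopologicalGroup 𝔤] (h : IsCoinduced ι ev) (hι : Continuous ι)
    (hinj : Function.Injective ι) (hopen : IsOpenMap ι) [ι.range.FiniteIndex] :
    Function.Surjective (h.h1Map hι) := by
  intro y
  induction y using Quotient.inductionOn with | _ b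
  -- `q x` is a representative of the right coset of `x`, and `x = ι (p x) * q x`.
  have : Finite (Quotient (QuotientGroup.rightRel ι.range)) :=
    .of_equiv _ (QuotientGroup.quotientRightRelEquivQuotientLeftRel ι.range).symm
  let q (x : 𝔤) : 𝔤 := (Quotient.mk (QuotientGroup.rightRel ι.range) x).out
  have hq (w : 𝔥) (x : 𝔤) : q (ι w * x) = q x :=
    congrArg Quotient.out (Quotient.sound (QuotientGroup.rightRel_apply.mpr
      ⟨w⁻¹, by rw [map_inv, mul_inv_rev, mul_inv_cancel_left]⟩))
  have hp' (x : 𝔤) : ∃ w, x = ι w * q x := by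
    obtain ⟨w, hw⟩ := QuotientGroup.rightRel_apply.mp
      (Quotient.exact (Quotient.out_eq (Quotient.mk (QuotientGroup.rightRel ι.range) x)))
    exact ⟨w, by rw [hw, inv_mul_cancel_right]⟩
  choose p hp using hp'
  have hpmul (w : 𝔥) (x : 𝔤) : p (ι w * x) = w * p x := by
    apply hinj
    have h1 := hp (ι w * x)
    nth_rw 1 [hq, hp x, ← mul_assoc] at h1
    rw [map_mul]
    exact (mul_right_cancel h1).symm
  have hqq (x : 𝔤) : q (q x) = q x := by
    conv_rhs => rw [hp x, hq]
  -- `x ↦ b (p x)` is constant on the left cosets of an open subgroup.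
  let U : OpenSubgroup 𝔤 :=
    { toSubgroup := ⨅ c : Quotient (QuotientGroup.rightRel ι.range),
        (b.ker.toSubgroup.map ι).comap (MulAut.conj c.out).toMonoidHom
      isOpen' := by
        change IsOpen ((⨅ c : Quotient (QuotientGroup.rightRel ι.range),
          (b.ker.toSubgroup.map ι).comap (MulAut.conj c.out).toMonoidHom : Subgroup 𝔤) : Set 𝔤)
        rw [Subgroup.coe_iInf]
        refine isOpen_iInter_of_finite fun c => ?_
        refine (hopen _ b.ker.isOpen).preimage (?_ : Continuous fun x => c.out * x * c.out⁻¹)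
        fun_prop }
  have hU (x : 𝔤) {u : 𝔤} (hu : u ∈ U) : b (p (x * u)) = b (p x) := by
    obtain ⟨k, hk, hku⟩ := Subgroup.mem_iInf.mp hu (Quotient.mk _ x)
    replace hku : ι k = q x * u * (q x)⁻¹ := hku
    have hxu : x * u = ι (p x * k) * q x := by
      conv_lhs => rw [hp x]
      rw [map_mul, hku]
      group
    have : p (q x) = 1 := hinj (by
      have := hp (q x)
      rw [hqq] at this
      rw [map_one]
      exact right_eq_mul.mp this)
    rw [hxu, hpmul, this, mul_one, b.map_mul_of_mem_ker _ hk]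
  have hβ (w : 𝔥) (x : 𝔤) : b (p (ι w * x)) = b w * w • b (p x) := by
    rw [hpmul, b.map_mul]
  have key (g : 𝔤) : ∃ a : A, ∀ x, ev (x • a) = (b (p x))⁻¹ * b (p (x * g)) := by
    refine h.exists_eq _ (fun w x => ?_)
      ⟨U ⊓ U.comap (MulAut.conj g⁻¹).toMonoidHom (by
        change Continuous fun x => g⁻¹ * x * g⁻¹⁻¹
        fun_prop), fun y u hu => ?_⟩
    · rw [mul_assoc, hβ, hβ, smul_mul', smul_inv']
      group
    · rw [hU y hu.1, show y * u * g = y * g * (g⁻¹ * u * g⁻¹⁻¹) by group,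
        hU (u := g⁻¹ * u * g⁻¹⁻¹) _ hu.2]
  choose a ha using key
  refine ⟨Cocycle.cls ⟨a, ?_, fun g g' => h.ext _ _ fun x => ?_⟩, ?_⟩
  · refine (IsLocallyConstant.iff_exists_open _).mpr fun g =>
      ⟨(g⁻¹ * ·) ⁻¹' U, U.isOpen.preimage (continuous_const_mul _),
        by simp [one_mem], fun g' hg' => h.ext _ _ fun x => ?_⟩
    rw [ha, ha, ← hU (x * g) hg']
    congr 3
    group
  · rw [smul_mul', map_mul, ← mul_smul, ha, ha, ha, mul_assoc x]
    group
  · refine Quotient.sound ⟨(b (p 1))⁻¹, fun w => ?_⟩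
    change b w = _ * ev (a (ι w)) * _
    rw [← one_smul 𝔤 (a (ι w)), ha, one_mul, ← mul_one (ι w), hβ, smul_inv']
    group

end IsCoinduced

namespace IsCoinduced

variable {ι : 𝔥 →* 𝔤} {ev : A →* B} {N : Subgroup 𝔤} {N' : Subgroup 𝔥}

/-- The evaluation map restricted to the invariants of subgroups `N` and `N' = ι⁻¹(N)`. -/
def evFixed (h : IsCoinduced ι ev) (hN : N.comap ι = N') :
    FixedPoints.subgroup N A →* FixedPoints.subgroup N' B :=
  (ev.comp (FixedPoints.subgroup N A).subtype).codRestrict _ fun a n => by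
    have hn : ι n ∈ N := by rw [← Subgroup.mem_comap, hN]; exact n.2
    change (n : 𝔥) • ev a = ev a
    rw [← h.map_smul]
    exact congrArg ev (a.2 ⟨ι n, hn⟩)

variable [N.Normal] [N'.Normal]

/-- The invariants of a normal subgroup `N` in a coinduced group are coinduced from the invariants
of `ι⁻¹(N)`. -/
theorem fixed (h : IsCoinduced ι ev) (hN : N.comap ι = N') :
    IsCoinduced (QuotientGroup.map N' N ι hN.ge) (h.evFixed hN) where
  map_smul w a := by
    induction w using QuotientGroup.induction_on with | H w
    exact Subtype.ext (h.map_smul w a)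
  ext a a' haa' := Subtype.ext (h.ext _ _ fun x => congrArg Subtype.val (haa' x))
  exists_eq f hf := by
    rintro ⟨U, hU⟩
    obtain ⟨a, ha⟩ := h.exists_eq (fun x => (f x : B))
      (fun w x => congrArg Subtype.val (hf w x))
      ⟨U.comap (QuotientGroup.mk' N) QuotientGroup.continuous_mk, fun y u hu =>
        congrArg Subtype.val (hU y u hu)⟩
    refine ⟨⟨a, fun n => h.ext _ _ fun x => ?_⟩, fun x => ?_⟩
    · change ev (x • (n : 𝔤) • a) = _
      rw [← mul_smul, ha, ha, QuotientGroup.mk_mul_of_mem x n.2]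
    · induction x using QuotientGroup.induction_on with | H x
      exact Subtype.ext (ha x)

end IsCoinduced

/-- Evaluation at `1`, on an induced group. -/
def Ind.evalOne (ι : 𝔥 →* 𝔤) (B : Type*) [Group B] [MulDistribMulAction 𝔥 B] : Ind ι B →* B where
  toFun f := f 1
  map_one' := rfl
  map_mul' _ _ := rfl

theorem isCoinduced_ind [IsTopologicalGroup 𝔤] (ι : 𝔥 →* 𝔤) (B : Type*) [Group B]
    [MulDistribMulAction 𝔥 B] : IsCoinduced ι (Ind.evalOne ι B) where
  map_smul w a := by
    have h := a.2.1 w 1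
    rw [mul_one] at h
    exact (congrArg a (one_mul (ι w))).trans h
  ext a a' h := Ind.ext fun x => by
    have h : a (1 * x) = a' (1 * x) := h x
    rwa [one_mul] at h
  exists_eq f hf hU := ⟨⟨f, hf, hU⟩, fun x => congrArg f (one_mul x)⟩

/-- Shapiro's lemma for an open subgroup of finite index, and its refinement for the quotients by
a normal subgroup `N` and by its preimage. -/
theorem shapiro_refinement [IsTopologicalGroup 𝔤] [TopologicalSpace 𝔥] [IsTopologicalGroup 𝔥]
    (ι : 𝔥 →* 𝔤) (B : Type*)
    [Group B] [MulDistribMulAction 𝔥 B] (hι : Continuous ι) (hinj : Function.Injective ι)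
    (hopen : IsOpenMap ι) [ι.range.FiniteIndex] (N : Subgroup 𝔤) [N.Normal] (N' : Subgroup 𝔥)
    [N'.Normal] (hN : N.comap ι = N') :
    (Function.Bijective (shapiro ι B hι) ∧ shapiro ι B hι 1 = 1) ∧
    ∃! Φ : H1 (𝔤 ⧸ N) (FixedPoints.subgroup N (Ind ι B)) →
        H1 (𝔥 ⧸ N') (FixedPoints.subgroup N' B),
      Function.Bijective Φ ∧ Φ 1 = 1 ∧
      (∀ a : Cocycle (𝔤 ⧸ N) (FixedPoints.subgroup N (Ind ι B)),
        ∃ b : Cocycle (𝔥 ⧸ N') (FixedPoints.subgroup N' B),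
          (∀ w : 𝔥, (b (w : 𝔥 ⧸ N') : B) = (a ((ι w : 𝔤) : 𝔤 ⧸ N)).1 1) ∧ Φ a.cls = b.cls) ∧
      ∀ x, H1.inflation B N' (Φ x) = shapiro ι B hι (H1.inflation (Ind ι B) N x) := by
  have h := isCoinduced_ind ι B
  refine ⟨⟨⟨h.h1Map_injective hι, h.h1Map_surjective hι hinj hopen⟩, h.h1Map_one hι⟩, ?_⟩
  have hι' : Continuous (QuotientGroup.map N' N ι hN.ge) :=
    QuotientGroup.continuous_mk.comp hι |>.quotient_lift _
  have hinj' : Function.Injective (QuotientGroup.map N' N ι hN.ge) := by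
    rw [injective_iff_map_eq_one]
    intro w
    induction w using QuotientGroup.induction_on with | H w
    intro hw
    rw [QuotientGroup.map_mk, QuotientGroup.eq_one_iff, ← Subgroup.mem_comap, hN] at hw
    exact (QuotientGroup.eq_one_iff w).mpr hw
  have hopen' : IsOpenMap (QuotientGroup.map N' N ι hN.ge) := fun V hV => by
    convert QuotientGroup.isOpenMap_coe _ (hopen _ (hV.preimage QuotientGroup.continuous_mk)) using 1
    rw [← Set.image_comp, ← Function.Surjective.image_preimage QuotientGroup.mk_surjective V,
      ← Set.image_comp, Function.Surjective.image_preimage QuotientGroup.mk_surjective V]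
    rfl
  have hfin : (QuotientGroup.map N' N ι hN.ge).range.FiniteIndex := by
    have : (QuotientGroup.map N' N ι hN.ge).range = ι.range.map (QuotientGroup.mk' N) := by
      ext x
      constructor
      · rintro ⟨w, rfl⟩
        induction w using QuotientGroup.induction_on with | H w
        exact ⟨ι w, ⟨w, rfl⟩, rfl⟩
      · rintro ⟨-, ⟨w, rfl⟩, rfl⟩
        exact ⟨w, rfl⟩
    rw [this]
    exact ⟨ne_zero_of_dvd_ne_zero Subgroup.FiniteIndex.index_ne_zero
      (Subgroup.index_map_dvd _ (QuotientGroup.mk'_surjective N))⟩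
  refine ⟨(h.fixed hN).h1Map hι', ⟨⟨(h.fixed hN).h1Map_injective hι',
    (h.fixed hN).h1Map_surjective hι' hinj' hopen'⟩, (h.fixed hN).h1Map_one hι',
    fun a => ⟨(h.fixed hN).cocycleMap hι' a, fun w => rfl, rfl⟩, fun x => ?_⟩, ?_⟩
  · induction x using Quotient.inductionOn
    rfl
  · rintro Φ ⟨-, -, hΦ, -⟩
    funext x
    induction x using Quotient.inductionOn with | _ a
    obtain ⟨b, hb, hab⟩ := hΦ a
    refine hab.trans (congrArg Cocycle.cls (?_ : b = (h.fixed hN).cocycleMap hι' a))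
    have : b.toFun = ((h.fixed hN).cocycleMap hι' a).toFun := funext fun w => by
      induction w using QuotientGroup.induction_on with | H w
      exact Subtype.ext (hb w)
    cases b
    cases this
    rfl

end Shapiro

/-! ### Ramification subgroups of Weil groups -/

section Restriction

variable {F K L P Ω : Type*} [Field F] [Field K] [Field L] [Field P] [Field Ω] [Algebra F K]
  [Algebra K L] [Algebra K P] [Algebra K Ω] [Algebra L P] [Algebra L Ω] [Algebra P Ω]
  [IsScalarTower K L P] [IsScalarTower K L Ω] [IsScalarTower K P Ω] [IsScalarTower L P Ω]
  [Normal K L] [Normal K P]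

theorem restrictNormalHom_restrictNormalHom (σ : Gal(Ω/K)) :
    AlgEquiv.restrictNormalHom L (AlgEquiv.restrictNormalHom P σ) =
      AlgEquiv.restrictNormalHom L σ := by
  refine AlgEquiv.ext fun x => (algebraMap L Ω).injective ?_
  refine Eq.trans ?_ (AlgEquiv.restrictNormal_commutes σ L x).symm
  rw [IsScalarTower.algebraMap_apply L P Ω]
  refine (congrArg _ (AlgEquiv.restrictNormal_commutes (σ.restrictNormal P) L x)).trans ?_
  refine (AlgEquiv.restrictNormal_commutes σ P _).trans ?_
  rw [← IsScalarTower.algebraMap_apply]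

variable [Algebra F Ω] [IsScalarTower F K Ω] [Algebra F P] [IsScalarTower F P Ω]
  [IsScalarTower F K P] [Normal F P]

theorem restrictNormalHom_restrictScalarsHom (σ : Gal(Ω/K)) :
    AlgEquiv.restrictNormalHom P (AlgEquiv.restrictScalarsHom F σ) =
      AlgEquiv.restrictScalarsHom F (AlgEquiv.restrictNormalHom P σ) := by
  refine AlgEquiv.ext fun x => (algebraMap P Ω).injective ?_
  exact (AlgEquiv.restrictNormal_commutes (AlgEquiv.restrictScalarsHom F σ) P x).trans
    (AlgEquiv.restrictNormal_commutes σ P x).symm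

end Restriction

section WeilRam

section

variable {R K Ω : Type*} [CommRing R] [Field K] [Field Ω] [Algebra R K] [Algebra R Ω] [Algebra K Ω]
  [IsScalarTower R K Ω] {r v : ℝ}

theorem mem_weilRam_iff {w : WeilGroup R K Ω} :
    w ∈ weilRam R K Ω v ↔ ∀ L : FiniteGaloisIntermediateField K Ω,
      AlgEquiv.restrictNormalHom L (WeilGroup.toGal R K Ω w) ∈ upperRam R K L v := by
  rw [weilRam, Subgroup.mem_iInf]
  rfl

theorem weilRam_anti {w : ℝ} (hv : 0 ≤ v) (h : v ≤ w) : weilRam R K Ω w ≤ weilRam R K Ω v :=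
  fun _ hx => mem_weilRam_iff.mpr fun L => upperRam_antitone hv h (mem_weilRam_iff.mp hx L)

theorem directed_weilRam (hr : 0 ≤ r) :
    Directed (· ≤ ·) fun s : Set.Ioi r => weilRam R K Ω s := fun s t =>
  ⟨min s t, weilRam_anti (hr.trans (min s t).2.le) (min_le_left _ _),
    weilRam_anti (hr.trans (min s t).2.le) (min_le_right _ _)⟩

end

variable {F K Ω : Type*} [Field F] [ValuativeRel F] [TopologicalSpace F]
  [IsNonarchimedeanLocalField F] [Field K] [Algebra F K] [FiniteDimensional F K]
  [Algebra.IsSeparable F K] [Field Ω] [Algebra K Ω]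

/-- Herbrand's theorem for the restrictions of an element of `Gal(Ω/K)` to finite Galois extensions
`L ⊆ P` of `K`. -/
theorem mem_upperRam_of_tower {L P : Type*} [Field L] [Field P] [Algebra F L]
    [Algebra F P] [Algebra K L] [Algebra K P] [Algebra L P] [Algebra L Ω] [Algebra P Ω]
    [IsScalarTower F K L] [IsScalarTower F K P] [IsScalarTower F L P] [IsScalarTower K L P]
    [IsScalarTower K L Ω] [IsScalarTower K P Ω] [IsScalarTower L P Ω] [FiniteDimensional K L]
    [FiniteDimensional K P] [IsGalois K L] [IsGalois K P] {v : ℝ} (hv : 0 ≤ v) {σ : Gal(Ω/K)}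
    (h : AlgEquiv.restrictNormalHom P σ ∈ upperRam 𝒪[F] K P v) :
    AlgEquiv.restrictNormalHom L σ ∈ upperRam 𝒪[F] K L v := by
  have : FiniteDimensional F L := .trans F K L
  have : FiniteDimensional F P := .trans F K P
  have : FiniteDimensional L P := .right K L P
  have : Algebra.IsSeparable F L := .trans F K L
  have : Algebra.IsSeparable F P := .trans F K P
  have := HasLocalIntegers.of_finiteDimensional F L
  have := HasLocalIntegers.of_finiteDimensional F P
  rw [← restrictNormalHom_restrictNormalHom (P := P), ← map_upperRam (L := P) hv]
  exact Subgroup.mem_map_of_mem _ h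

variable [Algebra F Ω] [IsScalarTower F K Ω]

/-- The ramification condition on an element of the Weil group, for an arbitrary field which is
finite and Galois over `K` and embedded in `Ω`. -/
theorem restrictNormalHom_mem_upperRam {P : Type*} [Field P] [Algebra F P]
    [Algebra K P] [Algebra P Ω] [IsScalarTower F K P] [IsScalarTower K P Ω] [FiniteDimensional K P]
    [IsGalois K P] {v : ℝ} (hv : 0 ≤ v) {w : WeilGroup 𝒪[F] K Ω} (hw : w ∈ weilRam 𝒪[F] K Ω v) :
    AlgEquiv.restrictNormalHom P (WeilGroup.toGal 𝒪[F] K Ω w) ∈ upperRam 𝒪[F] K P v := by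
  let e := AlgEquiv.ofInjectiveField (IsScalarTower.toAlgHom K P Ω)
  let P₀ : FiniteGaloisIntermediateField K Ω :=
    { toIntermediateField := (IsScalarTower.toAlgHom K P Ω).fieldRange
      finiteDimensional := e.toLinearEquiv.finiteDimensional
      isGalois := .of_algEquiv e }
  have hP (x : P) : algebraMap P Ω x ∈ P₀.toIntermediateField := ⟨x, rfl⟩
  let _ : Algebra P P₀ := ((algebraMap P Ω).codRestrict P₀.toIntermediateField hP).toAlgebra
  have : IsScalarTower P P₀ Ω := .of_algebraMap_eq fun _ => rfl
  have : IsScalarTower K P P₀ := .of_algebraMap_eq fun x => Subtype.ext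
    (IsScalarTower.algebraMap_apply K P Ω x)
  have : IsScalarTower F P P₀ := .of_algebraMap_eq fun x => by
    rw [IsScalarTower.algebraMap_apply F K P, ← IsScalarTower.algebraMap_apply K P P₀]
    exact Subtype.ext (IsScalarTower.algebraMap_apply F K Ω x)
  have := P₀.finiteDimensional
  have := P₀.isGalois
  exact mem_upperRam_of_tower hv (mem_weilRam_iff.mp hw P₀)

end WeilRam

section Comap

variable (F E Ω : Type*) [Field F] [ValuativeRel F] [TopologicalSpace F]
  [IsNonarchimedeanLocalField F] [Field E] [Algebra F E] [FiniteDimensional F E] [IsGalois F E]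
  [Field Ω] [Algebra F Ω] [Algebra E Ω] [IsScalarTower F E Ω]

variable {F E Ω} in
theorem restrictNormalHom_mem_upperRam_iff (P : Type*) [Field P] [Algebra F P] [Algebra E P]
    [Algebra P Ω] [IsScalarTower F E P] [IsScalarTower F P Ω] [IsScalarTower E P Ω]
    [FiniteDimensional F P] [IsGalois F P] [IsGalois E P] {v : ℝ} (hv : 0 ≤ v)
    (w : WeilGroup 𝒪[F] E Ω) :
    AlgEquiv.restrictNormalHom P (WeilGroup.toGal 𝒪[F] F Ω (weilIncl F E Ω w)) ∈
        upperRam 𝒪[F] F P v ↔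
      AlgEquiv.restrictNormalHom P (WeilGroup.toGal 𝒪[F] E Ω w) ∈
        upperRam 𝒪[F] E P (herbrandPsi 𝒪[F] F E v) := by
  have : FiniteDimensional E P := .right F E P
  have := HasLocalIntegers.of_finiteDimensional F E
  have := HasLocalIntegers.of_finiteDimensional F P
  rw [weilIncl_toGal, restrictNormalHom_restrictScalarsHom, restrictScalars_mem_upperRam_iff hv]

variable [IsSepClosure F Ω]

theorem weilIncl_mem_weilRam_iff {v : ℝ} (hv : 0 ≤ v) (w : WeilGroup 𝒪[F] E Ω) :
    weilIncl F E Ω w ∈ weilRam 𝒪[F] F Ω v ↔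
      w ∈ weilRam 𝒪[F] E Ω (herbrandPsi 𝒪[F] F E v) := by
  have hψ : 0 ≤ herbrandPsi 𝒪[F] F E v := herbrandPsi_nonneg hv
  have hΩ : IsGalois E Ω := .tower_top_of_isGalois F E Ω
  constructor
  · -- The Galois closure over `F` of an extension of `E` serves to compare both conditions.
    refine fun hw => mem_weilRam_iff.mpr fun L => ?_
    have : FiniteDimensional F L := .trans F E L
    have : IsScalarTower F L Ω := .of_algebraMap_eq fun _ => rfl
    let P := IntermediateField.normalClosure F L Ω
    let _ : Algebra E P := ((algebraMap L P).comp (algebraMap E L)).toAlgebra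
    have : IsScalarTower E L P := .of_algebraMap_eq fun _ => rfl
    have : IsScalarTower E P Ω := .of_algebraMap_eq fun _ => rfl
    have : IsScalarTower F E P := .of_algebraMap_eq fun x => Subtype.ext
      (IsScalarTower.algebraMap_apply F E Ω x)
    have : IsGalois F P := { }
    have : IsGalois E P := .tower_top_of_isGalois F E P
    have : FiniteDimensional E P := .right F E P
    refine mem_upperRam_of_tower (P := P) hψ ?_
    rw [← restrictNormalHom_mem_upperRam_iff P hv]
    exact restrictNormalHom_mem_upperRam hv hw
  · -- Here the compositum of `E` and of an extension of `F` does.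
    refine fun hw => mem_weilRam_iff.mpr fun L => ?_
    let e := AlgEquiv.ofInjectiveField (IsScalarTower.toAlgHom F E Ω)
    let E₀ : FiniteGaloisIntermediateField F Ω :=
      { toIntermediateField := (IsScalarTower.toAlgHom F E Ω).fieldRange
        finiteDimensional := e.toLinearEquiv.finiteDimensional
        isGalois := .of_algEquiv e }
    let P := L ⊔ E₀
    have hEP (x : E) : algebraMap E Ω x ∈ P.toIntermediateField :=
      (le_sup_right : E₀ ≤ P) ⟨x, rfl⟩
    let _ : Algebra E P := ((algebraMap E Ω).codRestrict P.toIntermediateField hEP).toAlgebra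
    let _ : Algebra L P := (IntermediateField.inclusion (le_sup_left : L ≤ P)).toRingHom.toAlgebra
    have : IsScalarTower F L P := .of_algebraMap_eq fun _ => rfl
    have : IsScalarTower L P Ω := .of_algebraMap_eq fun _ => rfl
    have : IsScalarTower E P Ω := .of_algebraMap_eq fun _ => rfl
    have : IsScalarTower F E P := .of_algebraMap_eq fun x => Subtype.ext
      (IsScalarTower.algebraMap_apply F E Ω x)
    have : IsGalois E P := .tower_top_of_isGalois F E P
    have : FiniteDimensional E P := .right F E P
    refine mem_upperRam_of_tower (P := P) hv ?_
    rw [restrictNormalHom_mem_upperRam_iff P hv]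
    exact restrictNormalHom_mem_upperRam hψ hw

theorem comap_iSup_weilRam {r : ℝ} (hr : 0 ≤ r) :
    (⨆ s : Set.Ioi r, weilRam 𝒪[F] F Ω s).comap (weilIncl F E Ω) =
      ⨆ s : Set.Ioi (herbrandPsi 𝒪[F] F E r), weilRam 𝒪[F] E Ω s := by
  have hψ : 0 ≤ herbrandPsi 𝒪[F] F E r := herbrandPsi_nonneg hr
  have : Nonempty (Set.Ioi r) := Set.nonempty_Ioi.to_subtype
  have : Nonempty (Set.Ioi (herbrandPsi 𝒪[F] F E r)) := Set.nonempty_Ioi.to_subtype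
  ext w
  rw [Subgroup.mem_comap, Subgroup.mem_iSup_of_directed (directed_weilRam hr),
    Subgroup.mem_iSup_of_directed (directed_weilRam hψ)]
  constructor
  · rintro ⟨⟨s, hs⟩, hw⟩
    have hs0 : 0 ≤ s := hr.trans (le_of_lt hs)
    exact ⟨⟨herbrandPsi 𝒪[F] F E s, (herbrandPsi_lt_iff hr hs0).mpr hs⟩,
      (weilIncl_mem_weilRam_iff F E Ω hs0 w).mp hw⟩
  · rintro ⟨⟨s, hs⟩, hw⟩
    have hs0 : 0 ≤ s := hψ.trans (le_of_lt hs)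
    have hφ := herbrandPhi_nonneg (R := 𝒪[F]) (K := F) (L := E) hs0
    refine ⟨⟨herbrandPhi 𝒪[F] F E s, ?_⟩, ?_⟩
    · rw [Set.mem_Ioi, ← herbrandPsi_lt_iff (R := 𝒪[F]) (K := F) (L := E) hr hφ,
        herbrandPsi_herbrandPhi]
      exact hs
    · rw [weilIncl_mem_weilRam_iff F E Ω hφ, herbrandPsi_herbrandPhi]
      exact hw

/-- The refined form of `W_E ∩ W_F^r = W_E^{ψ(r)}`. -/
theorem comap_weilRamPlus {r : ℝ} (hr : 0 ≤ r) :
    (weilRamPlus 𝒪[F] F Ω r).comap (weilIncl F E Ω) =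
      weilRamPlus 𝒪[F] E Ω (herbrandPsi 𝒪[F] F E r) := by
  rw [weilRamPlus, weilRamPlus, ← comap_iSup_weilRam F E Ω hr]
  refine SetLike.coe_injective ?_
  exact (isOpenMap_weilIncl F E Ω).preimage_closure_eq_closure_preimage
    (continuous_weilIncl F E Ω) _

end Comap

end LocalShapiro

end

theorem theorem2 {F E Ω : Type*}
    [Field F] [ValuativeRel F] [TopologicalSpace F] [IsNonarchimedeanLocalField F]
    [Field E] [Algebra F E] [FiniteDimensional F E] [IsGalois F E]
    [Field Ω] [Algebra F Ω] [Algebra E Ω] [IsScalarTower F E Ω] [IsSepClosure F Ω]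
    {H : Type*} [CommRing H] [HopfAlgebra E H]
    (_hG : IsConnectedReductive E H (AlgebraicClosure Ω))
    (D : LanglandsDual E Ω H) (r : ℝ) (_hr : 0 ≤ r) :
    let ι := weilIncl F E Ω
    let Sh := shapiro ι D.dualGroup (continuous_weilIncl F E Ω)
    let N_F := weilRamPlus 𝒪[F] F Ω r
    let N_E := weilRamPlus 𝒪[F] E Ω (herbrandPsi 𝒪[F] F E r)
    (Function.Bijective Sh ∧ Sh 1 = 1) ∧
    ∃! Φ : H1 (WeilGroup 𝒪[F] F Ω ⧸ N_F)
          (FixedPoints.subgroup N_F (WeilRestrictionDual F D)) →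
        H1 (WeilGroup 𝒪[F] E Ω ⧸ N_E)
          (FixedPoints.subgroup N_E D.dualGroup),
      Function.Bijective Φ ∧ Φ 1 = 1 ∧
      (∀ a : Cocycle (WeilGroup 𝒪[F] F Ω ⧸ N_F)
            (FixedPoints.subgroup N_F (WeilRestrictionDual F D)),
          ∃ b : Cocycle (WeilGroup 𝒪[F] E Ω ⧸ N_E) (FixedPoints.subgroup N_E D.dualGroup), (∀ w : WeilGroup 𝒪[F] E Ω,
          (b (w : WeilGroup 𝒪[F] E Ω ⧸ N_E) : D.dualGroup) =
            (a ((ι w : WeilGroup 𝒪[F] F Ω) :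
              WeilGroup 𝒪[F] F Ω ⧸ N_F)).1 1) ∧
          Φ a.cls = b.cls) ∧
      ∀ x, H1.inflation D.dualGroup N_E (Φ x) =
        Sh (H1.inflation (WeilRestrictionDual F D) N_F x) := by
  have := finiteIndex_range_weilIncl F E Ω
  exact shapiro_refinement (weilIncl F E Ω) D.dualGroup (continuous_weilIncl F E Ω)
    (weilIncl_injective F E Ω) (isOpenMap_weilIncl F E Ω) _ _ (comap_weilRamPlus F E Ω _hr)
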